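/- Let $K$ be a field of characteristic $0$, let $N\ge 1$ be an integer, and fix a base point $(t^0,x^0,s^0)$ with $t^0=(t^0_1,t^0_2,\dots)$, only finitely many $t^0_n\neq 0$. All functions of $t=(t_1,t_2,\dots)$, $x$, $s$ are formal power series over $K$ in $t_n-t^0_n$ ($n\ge1$), $x-x^0$, $s-s^0$. Series in $k$ depending on $(t,x,s)$ are elements of $\mathcal R=K((k^{-1}))[[t_n-t^0_n\ (n\ge 1),\,x-x^0,\,s-s^0]]$, and infinite sums are taken for coefficientwise ($k^{-1}$-adic) convergence. For $F\in\mathcal R$ let $(F)_{\ge m}$ and $(F)_{<m}$ be its parts with powers $k^j$, $j\ge m$, resp. $j<m$. Put $\{F,G\}=\frac{\partial F}{\partial k}\frac{\partial G}{\partial x}-\frac{\partial F}{\partial x}\frac{\partial G}{\partial k}$. Let $$\mathcal L=k+\sum_{n\ge1}u_{n+1}(t,x,s)\,k^{-n},\qquad \mathcal M=\sum_{n\ge1}n t_n\mathcal L^{n-1}+x+Ns\,\mathcal L^{-1}+\sum_{n\ge1}v_n(t,x,s)\,\mathcal L^{-n-1},$$ $$\mathcal P=k^N+p_{N-1}(t,x,s)k^{N-1}+\dots+p_0(t,x,s).$$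 Let $f(k,x,s)$, $g(k,x,s)$ be twistor functions, given by expansions $$f=\sum_{a,b\ge0}f_{ab}(k)\,(x-c(k))^a(s-s^0)^b,\qquad g=\sum_{a,b\ge0}g_{ab}(k)\,(x-c(k))^a(s-s^0)^b$$ with arbitrary $f_{ab},g_{ab}\in K((k^{-1}))$ along a curve $x=c(k)$, $c\in K((k^{-1}))$, which passes through the base values of $(\mathcal L,\mathcal M)$, i.e. $\mathcal M=c(\mathcal L)$ at $(t,x,s)=(t^0,x^0,s^0)$ (so that substituting $k=\mathcal L$, $x=\mathcal M$ makes sense). Suppose $\{f,g\}=1$ identically in $(k,x,s)$, and set $\hat{\mathcal L}=f(\mathcal L,\mathcal M,s)$, $\hat{\mathcal M}=g(\mathcal L,\mathcal M,s)$. Assume $$(\hat{\mathcal L})_{<0}=0,\qquad(\hat{\mathcal M})_{<0}=0,$$ $$\Bigl(\mathcal P\frac{\partial\hat{\mathcal L}}{\partial s}-\{\mathcal P,\hat{\mathcal L}\}-\mathcal P\,\frac{\partial f}{\partial s}(\mathcal L,\mathcal M,s)\Bigr)_{<N-1}=0,\qquad \Bigl(\mathcal P\frac{\partial\hat{\mathcal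 M}}{\partial s}-\{\mathcal P,\hat{\mathcal M}\}-\mathcal P\,\frac{\partial g}{\partial s}(\mathcal L,\mathcal M,s)\Bigr)_{<N-1}=0,$$ where $\frac{\partial f}{\partial s}(\mathcal L,\mathcal M,s)$ is the partial derivative of $f(k,x,s)$ in $s$ evaluated at $k=\mathcal L$, $x=\mathcal M$, and likewise for $g$. Then $(\mathcal L,\mathcal M,\mathcal P)$ is a solution of the dispersionless $N$-modified KP hierarchy: with $\mathcal B_n=(\mathcal L^n)_{\ge0}$, for all $n\ge1$, $$\frac{\partial\mathcal L}{\partial t_n}=\{\mathcal B_n,\mathcal L\},\quad\frac{\partial\mathcal M}{\partial t_n}=\{\mathcal B_n,\mathcal M\},\quad\{\mathcal L,\mathcal M\}=1,$$ $$\frac{\partial\mathcal L}{\partial s}\mathcal P=\{\mathcal P,\mathcal L\},\quad\frac{\partial\mathcal M}{\partial s}\mathcal P=\{\mathcal P,\mathcal M\},\quad-\frac{\partial\mathcal B_n}{\partial s}\mathcal P=-\frac{\partial\mathcal P}{\partial t_n}-\{\mathcal P,\mathcal B_n\}.$$ Moreover $\mathcal P=\mathcal Q$, where $\mathcal Q=\mathcal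 L^N\exp\bigl(-\sum_{n\ge1}\frac1n\frac{\partial v_n}{\partial s}\mathcal L^{-n}\bigr)$. -/

import Mathlib

open scoped MvPowerSeries.WithPiTopology

noncomputable section

namespace DMKP

/-- The independent variables of the hierarchy: `x`, `s` and the times `t₁, t₂, …`. In the rings of
power series below, the formal variable attached to each of them is its deviation from a base
point. -/
inductive Var : Type
  | x : Var
  | s : Var
  | t : ℕ+ → Var

/-- The two parameters of a twistor function `f(k, x, s)` other than `k`. -/
inductive GVar : Type
  | x : GVar
  | s : GVar

variable {K : Type*} [Field K]

/-- Functions of `(t, x, s)`, expanded at the base point (no dependence on `k`). -/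
abbrev Coef (K : Type*) [Field K] : Type _ := MvPowerSeries Var K

/-- Laurent series in `k` depending on `(t, x, s)`: power series in the deviations of `(t, x, s)`
from the base point whose coefficients lie in the field of formal Laurent series in `k⁻¹`.
`LaurentSeries K` is used with `X = k⁻¹`: the coefficient of `k ^ j` is `φ.coeff (-j)`.
All infinite sums are taken for the topology of coefficientwise convergence, the field of Laurent
series having its `k⁻¹`-adic topology. -/
abbrev Ser (K : Type*) [Field K] : Type _ := MvPowerSeries Var (LaurentSeries K)

/-- The Laurent series `k ^ j`. -/
def kPow (K : Type*) [Field K] (j : ℤ) : LaurentSeries K := HahnSeries.single (-j) 1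

/-- `k ^ j` as an element of `Ser K`. -/
def k (K : Type*) [Field K] (j : ℤ) : Ser K := MvPowerSeries.C (kPow K j)

/-- Scalars. -/
def scal (a : K) : Ser K := MvPowerSeries.C (HahnSeries.C a)

/-- A function of `(t, x, s)` as an element of `Ser K`. -/
def emb (a : Coef K) : Ser K := MvPowerSeries.map (HahnSeries.C : K →+* LaurentSeries K) a

/-- `d/dk` on Laurent series; in terms of `X = k⁻¹` it is `-X² d/dX`. -/
def dk (φ : LaurentSeries K) : LaurentSeries K := -(kPow K (-2) * LaurentSeries.derivative K φ)

/-- `d/dk` applied to every coefficient of a power series. -/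
def Dk {σ : Type*} (F : MvPowerSeries σ (LaurentSeries K)) : MvPowerSeries σ (LaurentSeries K) :=
  fun α => dk (MvPowerSeries.coeff α F)

/-- Partial derivative with respect to one of the variables `x`, `s`, `tₙ`, at fixed `k`. -/
def D (w : Var) (F : Ser K) : Ser K := MvPowerSeries.pderiv (LaurentSeries K) w F

/-- `{F, G} = ∂F/∂k ∂G/∂x - ∂F/∂x ∂G/∂k`. -/
def poisson (F G : Ser K) : Ser K := Dk F * D .x G - D .x F * Dk G

/-- The projection `(·)_{≥ m}` onto the powers `k ^ j` with `m ≤ j`. -/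
def projGE (m : ℤ) (F : Ser K) : Ser K :=
  fun α => HahnSeries.truncLT (1 - m) (MvPowerSeries.coeff α F)

/-- The projection `(·)_{< m}` onto the powers `k ^ j` with `j < m`. -/
def projLT (m : ℤ) (F : Ser K) : Ser K := F - projGE m F

/-- A base point `(t⁰, x⁰, s⁰)`, with only finitely many nonzero `t⁰ₙ`. -/
structure BasePoint (K : Type*) [Field K] where
  t : ℕ+ →₀ K
  x : K
  s : K

/-- The function `tₙ`. -/
def BasePoint.tVar (b : BasePoint K) (n : ℕ+) : Ser K := scal (b.t n) + MvPowerSeries.X (.t n)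

/-- The function `x`. -/
def BasePoint.xVar (b : BasePoint K) : Ser K := scal b.x + MvPowerSeries.X .x

/-- The function `s`. -/
def BasePoint.sVar (b : BasePoint K) : Ser K := scal b.s + MvPowerSeries.X .s

/-- `𝓛 = k + u₂ k⁻¹ + u₃ k⁻² + ⋯`, where `u n` stands for `u_{n+1}`. -/
def calL (u : ℕ+ → Coef K) : Ser K := k K 1 + ∑' n : ℕ+, emb (u n) * k K (-(n : ℤ))

/-- `𝓜 = ∑ n tₙ 𝓛^{n-1} + x + N s 𝓛⁻¹ + ∑ vₙ 𝓛^{-n-1}`. -/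
def calM (N : ℕ) (b : BasePoint K) (L : Ser K) (v : ℕ+ → Coef K) : Ser K :=
  ∑' n : ℕ+, ((n : ℕ) : Ser K) * b.tVar n * L ^ ((n : ℕ) - 1)
    + b.xVar + (N : Ser K) * b.sVar * L⁻¹
    + ∑' n : ℕ+, emb (v n) * L⁻¹ ^ ((n : ℕ) + 1)

/-- `𝓟 = k^N + p_{N-1} k^{N-1} + ⋯ + p₀`. -/
def calP (N : ℕ) (p : Fin N → Coef K) : Ser K :=
  k K N + ∑ i : Fin N, emb (p i) * k K ((i : ℕ) : ℤ)

/-- `exp E = ∑ Eᵐ / m!`. -/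
def expSer (E : Ser K) : Ser K := ∑' m : ℕ, scal ((m.factorial : K)⁻¹) * E ^ m

/-- `𝓠 = 𝓛^N exp (-∑ (1/n) ∂vₙ/∂s 𝓛^{-n})`. -/
def calQ (N : ℕ) (L : Ser K) (v : ℕ+ → Coef K) : Ser K :=
  L ^ N * expSer (∑' n : ℕ+, scal (-((n : ℕ) : K)⁻¹) * D .s (emb (v n)) * L⁻¹ ^ (n : ℕ))

/-- `𝓑ₙ = (𝓛ⁿ)_{≥ 0}`. -/
def calB (L : Ser K) (n : ℕ+) : Ser K := projGE 0 (L ^ (n : ℕ))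

/-- The equations of the dispersionless modified KP hierarchy for `(𝓛, 𝓜, 𝓟)`. -/
structure IsSolution (L M P : Ser K) : Prop where
  lax_L : ∀ n : ℕ+, D (.t n) L = poisson (calB L n) L
  lax_M : ∀ n : ℕ+, D (.t n) M = poisson (calB L n) M
  ccr : poisson L M = 1
  s_L : D .s L * P = poisson P L
  s_M : D .s M * P = poisson P M
  B_P : ∀ n : ℕ+, -(D .s (calB L n)) * P = -(D (.t n) P) - poisson P (calB L n)

/-- A twistor function `f(k, x, s)`, expanded along a curve `x = c(k)`, `s = s⁰`:
`f(k, x, s) = ∑ f_{ab}(k) (x - c(k))^a (s - s⁰)^b`, with arbitrary Laurent series `f_{ab}`. -/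
abbrev Germ (K : Type*) [Field K] : Type _ := MvPowerSeries GVar (LaurentSeries K)

/-- `∂f/∂x` at fixed `k`, `s`. -/
def Germ.dx (f : Germ K) : Germ K := MvPowerSeries.pderiv (LaurentSeries K) .x f

/-- `∂f/∂s` at fixed `k`, `x`. -/
def Germ.ds (f : Germ K) : Germ K := MvPowerSeries.pderiv (LaurentSeries K) .s f

/-- `∂f/∂k` at fixed `x`, `s` (the expansion variable is `x - c(k)`). -/
def Germ.dk (c : LaurentSeries K) (f : Germ K) : Germ K :=
  Dk f - MvPowerSeries.C (DMKP.dk c) * f.dx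

/-- `{f, g} = ∂f/∂k ∂g/∂x - ∂f/∂x ∂g/∂k`. -/
def Germ.poisson (c : LaurentSeries K) (f g : Germ K) : Germ K :=
  f.dk c * g.dx - f.dx * g.dk c

/-- Integer powers. -/
def zpow (L : Ser K) : ℤ → Ser K
  | Int.ofNat n => L ^ n
  | Int.negSucc n => L⁻¹ ^ (n + 1)

/-- `φ(𝓛) = ∑ φ_j 𝓛^j` for a Laurent series `φ(k) = ∑ φ_j k^j`. -/
def evalL (φ : LaurentSeries K) (L : Ser K) : Ser K :=
  ∑' j : ℤ, scal (φ.coeff (-j)) * zpow L j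

/-- `f(𝓛, 𝓜, s) = ∑ f_{ab}(𝓛) (𝓜 - c(𝓛))^a (s - s⁰)^b`. -/
def Germ.eval (c : LaurentSeries K) (f : Germ K) (L M : Ser K) : Ser K :=
  ∑' d : GVar →₀ ℕ,
    evalL (MvPowerSeries.coeff d f) L * (M - evalL c L) ^ d .x * MvPowerSeries.X .s ^ d .s

end DMKP

end

/-!
The proof has three layers.

*Calculus.* Every coefficient of a series in `Ser K` is indexed by a monomial in the deviations and
a power of `k` (`kc`), and nearly everything is read off from the powers of `k` that occur: `Deg m F`
(no powers above `k ^ m`) and `GE m F` (none below). A series with `Deg m` and `GE n`, `m < n`,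
vanishes. `𝓛⁻¹` and `𝓟⁻¹` are geometric series, so they have the expected degrees
(`inv_of_leading`). The substitutions `φ ↦ φ(𝓛)` and `f ↦ f(𝓛, 𝓜, s)` are ring homomorphisms obeying
the chain rule (`map_evalL`, `map_eval`): both facts hold on monomials, and each side is determined
by its values on monomials (`laurent_dense`, `germ_dense`).

*The flows.* Since `{f, g} = 1`, the Jacobian of `(𝓛̂, 𝓜̂)` with respect to `(𝓛, 𝓜)` has
determinant `1`. Hence `{𝓛, 𝓜} = {𝓛̂, 𝓜̂}`, and the minors of the partial derivatives of
`(𝓛, 𝓜)` equal those of `(𝓛̂, 𝓜̂)`, which are polynomials in `k`. On the other hand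
`δ𝓜 = (∂𝓜/∂𝓛) δ𝓛 + (explicit part)` for each partial derivative `δ` (`map_calM`), so that the same
minors are known up to negative powers of `k`. This gives `{𝓛, 𝓜} = 1` and the `tₙ`-flows. For
`s` the same argument, with the bound `N - 1` in place of `0`, yields
`∂𝓟/∂k = 𝓟 · (N 𝓛⁻¹ + ∑ ∂vₙ/∂s 𝓛^{-n-1}) ∂𝓛/∂k`, which is the equation satisfied by `𝓠`. As
`𝓟` and `𝓠` have the same leading term, `𝓟 = 𝓠` (`eq_zero_of_logDeriv`). The companion minor plus
`∂ log 𝓟/∂x` does not depend on `k`, because the logarithmic derivatives of `𝓟` are closed and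
`∂{𝓛, 𝓜}/∂s = 0`; having negative degree, it vanishes. The two minors together are the
`s`-equations.

*Compatibility.* The `tₙ`- and `s`-flows of `𝓛` and `𝓜` commute, so the curvature
`∂𝓑ₙ/∂s - ∂ log 𝓟/∂tₙ - {log 𝓟, 𝓑ₙ}` Poisson-commutes with the canonical pair `𝓛, 𝓜` and does
not depend on `k`. It also has negative degree, because `𝓛ⁿ` satisfies the `s`-flow and `𝓑ₙ` differs
from it by negative powers. So it vanishes, which is the last equation.
-/

noncomputable section

namespace DMKP

variable {K : Type*} [Field K]

/-! ### Coefficients and supports -/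

/-- The coefficient of `k ^ j` in the coefficient of the monomial `α`. -/
def kc {σ : Type*} (α : σ →₀ ℕ) (j : ℤ) : MvPowerSeries σ (LaurentSeries K) →+ K where
  toFun F := (MvPowerSeries.coeff α F).coeff (-j)
  map_zero' := by simp
  map_add' := by simp

theorem kc_apply {σ : Type*} (α : σ →₀ ℕ) (j : ℤ) (F : MvPowerSeries σ (LaurentSeries K)) :
    kc α j F = (MvPowerSeries.coeff α F).coeff (-j) := rfl

theorem ext_kc {σ : Type*} {F G : MvPowerSeries σ (LaurentSeries K)}
    (h : ∀ α j, kc α j F = kc α j G) : F = G := by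
  ext α i
  simpa [kc_apply] using h α (-i)

/-- `F` only involves powers `k ^ j` with `j ∈ A`. -/
def Supp (A : Set ℤ) (F : Ser K) : Prop := ∀ α j, kc α j F ≠ 0 → j ∈ A

/-- `F` has no powers `k ^ j` with `j > m`. -/
abbrev Deg (m : ℤ) (F : Ser K) : Prop := Supp (Set.Iic m) F

/-- `F` has no powers `k ^ j` with `j < m`. -/
abbrev GE (m : ℤ) (F : Ser K) : Prop := Supp (Set.Ici m) F

theorem Supp.mono {A B : Set ℤ} {F : Ser K} (h : Supp A F) (hAB : A ⊆ B) : Supp B F :=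
  fun α j hj => hAB (h α j hj)

theorem Deg.mono {m n : ℤ} {F : Ser K} (h : Deg m F) (hmn : m ≤ n) : Deg n F :=
  Supp.mono h (Set.Iic_subset_Iic.2 hmn)

theorem GE.mono {m n : ℤ} {F : Ser K} (h : GE m F) (hmn : n ≤ m) : GE n F :=
  Supp.mono h (Set.Ici_subset_Ici.2 hmn)

theorem Supp.zero (A : Set ℤ) : Supp A (0 : Ser K) := fun _ _ h => absurd (map_zero _) h

theorem Supp.add {A : Set ℤ} {F G : Ser K} (hF : Supp A F) (hG : Supp A G) : Supp A (F + G) := by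
  intro α j h
  by_contra hj
  refine h ?_
  rw [map_add, not_not.1 (fun h => hj (hF α j h)), not_not.1 (fun h => hj (hG α j h)), add_zero]

theorem Supp.neg {A : Set ℤ} {F : Ser K} (hF : Supp A F) : Supp A (-F) := by
  intro α j h
  rw [map_neg] at h
  exact hF α j (neg_ne_zero.1 h)

theorem Supp.sub {A : Set ℤ} {F G : Ser K} (hF : Supp A F) (hG : Supp A G) : Supp A (F - G) := by
  rw [sub_eq_add_neg]
  exact hF.add hG.neg

theorem Supp.sum {ι : Type*} {A : Set ℤ} {F : ι → Ser K} (s : Finset ι)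
    (h : ∀ i ∈ s, Supp A (F i)) : Supp A (∑ i ∈ s, F i) :=
  Finset.sum_induction F (Supp A) (fun _ _ => Supp.add) (Supp.zero A) h

open scoped Pointwise in
theorem Supp.mul {A B : Set ℤ} {F G : Ser K} (hF : Supp A F) (hG : Supp B G) :
    Supp (A + B) (F * G) := by
  classical
  intro α j h
  by_contra hj
  refine h ?_
  rw [kc_apply, MvPowerSeries.coeff_mul, HahnSeries.coeff_sum]
  refine Finset.sum_eq_zero fun p _ => ?_
  rw [HahnSeries.coeff_mul]
  refine Finset.sum_eq_zero fun q hq => ?_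
  have hq' : q.1 + q.2 = -j := by simpa using ((Finset.mem_antidiagonal).1 hq).2.2
  by_contra hne
  have h1 := hF p.1 (-q.1) (by rw [kc_apply, neg_neg]; exact left_ne_zero_of_mul hne)
  have h2 := hG p.2 (-q.2) (by rw [kc_apply, neg_neg]; exact right_ne_zero_of_mul hne)
  exact hj (Set.mem_add.2 ⟨_, h1, _, h2, by omega⟩)

theorem Deg.mul {a b : ℤ} {F G : Ser K} (hF : Deg a F) (hG : Deg b G) : Deg (a + b) (F * G) :=
  (Supp.mul hF hG).mono (by
    rintro _ ⟨x, hx, y, hy, rfl⟩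
    simp only [Set.mem_Iic] at *
    omega)

theorem GE.mul {a b : ℤ} {F G : Ser K} (hF : GE a F) (hG : GE b G) : GE (a + b) (F * G) :=
  (Supp.mul hF hG).mono (by
    rintro _ ⟨x, hx, y, hy, rfl⟩
    simp only [Set.mem_Ici] at *
    omega)

/-- The way all equations between series are obtained: one side bounds the degree from above, the
other from below. -/
theorem eq_zero_of_deg_ge {m n : ℤ} {F : Ser K} (h : Deg m F) (h' : GE n F) (hmn : m < n) :
    F = 0 := by
  refine ext_kc fun α j => ?_
  rw [map_zero]
  by_contra hj
  have h1 : j ≤ m := h α j hj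
  have h2 : n ≤ j := h' α j hj
  omega

theorem eq_zero_of_forall_deg {F : Ser K} (h : ∀ m : ℤ, Deg m F) : F = 0 := by
  refine ext_kc fun α j => ?_
  rw [map_zero]
  by_contra hj
  have : j ≤ j - 1 := h (j - 1) α j hj
  omega

theorem kc_k (α : Var →₀ ℕ) (i j : ℤ) [Decidable (α = 0)] :
    kc α j (k K i) = if α = 0 ∧ j = i then 1 else 0 := by
  classical
  rw [kc_apply, k, MvPowerSeries.coeff_C]
  by_cases hα : α = 0 <;> simp [hα, kPow, HahnSeries.coeff_single]

theorem kc_emb_mul_k (α : Var →₀ ℕ) (a : Coef K) (i j : ℤ) :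
    kc α j (emb a * k K i) = if j = i then MvPowerSeries.coeff α a else 0 := by
  rw [kc_apply, k, MvPowerSeries.coeff_mul_C, emb, MvPowerSeries.coeff_map, kPow,
    HahnSeries.C_apply, HahnSeries.single_mul_single, HahnSeries.coeff_single]
  simp

theorem kc_emb (α : Var →₀ ℕ) (a : Coef K) (j : ℤ) :
    kc α j (emb a) = if j = 0 then MvPowerSeries.coeff α a else 0 := by
  rw [kc_apply, emb, MvPowerSeries.coeff_map, HahnSeries.C_apply, HahnSeries.coeff_single]
  simp

theorem k_zero : k K 0 = 1 := by
  simp [k, kPow]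

theorem k_add (i j : ℤ) : k K (i + j) = k K i * k K j := by
  rw [k, k, k, ← map_mul, kPow, kPow, kPow, HahnSeries.single_mul_single, mul_one, neg_add]

theorem supp_emb (a : Coef K) : Supp {0} (emb a) := by
  intro α j h
  rw [kc_emb] at h
  by_contra hj
  exact h (if_neg hj)

theorem supp_k (i : ℤ) : Supp {i} (k K i) := by
  classical
  intro α j h
  rw [kc_k] at h
  by_contra hj
  exact h (if_neg (fun h => hj h.2))

theorem scal_eq_emb (a : K) : scal a = emb (MvPowerSeries.C a) := by
  rw [scal, emb, MvPowerSeries.map_C]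

theorem supp_scal (a : K) : Supp {0} (scal a) := scal_eq_emb a ▸ supp_emb _

theorem deg_emb (a : Coef K) : Deg 0 (emb a) := (supp_emb a).mono (by simp)
theorem deg_k (i : ℤ) : Deg i (k K i) := (supp_k i).mono (by simp)
theorem deg_scal (a : K) : Deg 0 (scal a) := (supp_scal a).mono (by simp)

theorem scal_one : scal (1 : K) = 1 := by simp [scal]
theorem scal_zero : scal (0 : K) = 0 := by simp [scal]
theorem scal_add (a b : K) : scal (a + b) = scal a + scal b := by simp [scal]
theorem scal_neg (a : K) : scal (-a) = -scal a := by simp [scal]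
theorem scal_mul (a b : K) : scal (a * b) = scal a * scal b := by
  simp only [scal, map_mul]
theorem scal_natCast (n : ℕ) : scal (n : K) = n := by
  simp only [scal, map_natCast]
theorem scal_intCast (n : ℤ) : scal (n : K) = n := by
  simp only [scal, map_intCast]

theorem deg_one : Deg 0 (1 : Ser K) := scal_one (K := K) ▸ deg_scal 1
theorem ge_one : GE 0 (1 : Ser K) := scal_one (K := K) ▸ (supp_scal 1).mono (by simp)
theorem deg_natCast (n : ℕ) : Deg 0 (n : Ser K) := scal_natCast (K := K) n ▸ deg_scal _

theorem Deg.scal_mul {m : ℤ} {F : Ser K} (a : K) (h : Deg m F) : Deg m (scal a * F) := by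
  simpa using (deg_scal a).mul h

theorem Deg.natCast_mul {m : ℤ} {F : Ser K} (n : ℕ) (h : Deg m F) : Deg m ((n : Ser K) * F) := by
  simpa using (deg_natCast n).mul h

theorem Deg.pow {m : ℤ} {F : Ser K} (h : Deg m F) (n : ℕ) : Deg (n * m) (F ^ n) := by
  induction n with
  | zero => simpa using deg_one
  | succ n ih => exact pow_succ F n ▸ (ih.mul h).mono (by push_cast; linarith)

theorem projGE_add_projLT (m : ℤ) (F : Ser K) : projGE m F + projLT m F = F := by
  rw [projLT, add_sub_cancel]

theorem kc_projGE (m : ℤ) (F : Ser K) (α : Var →₀ ℕ) (j : ℤ) :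
    kc α j (projGE m F) = if m ≤ j then kc α j F else 0 := by
  have : MvPowerSeries.coeff α (projGE m F)
    = HahnSeries.truncLT (1 - m) (MvPowerSeries.coeff α F) := rfl
  rw [kc_apply, this, HahnSeries.coeff_truncLT, kc_apply]
  congr 1
  exact propext ⟨fun h => by omega, fun h => by omega⟩

theorem ge_projGE (m : ℤ) (F : Ser K) : GE m (projGE m F) := by
  intro α j h
  rw [kc_projGE] at h
  by_contra hj
  exact h (if_neg hj)

theorem deg_projLT (m : ℤ) (F : Ser K) : Deg (m - 1) (projLT m F) := by
  intro α j h
  rw [projLT, map_sub, kc_projGE] at h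
  by_contra hj
  have : m ≤ j := by
    simp only [Set.mem_Iic] at hj
    omega
  exact h (by rw [if_pos this, sub_self])

theorem ge_of_projLT {m : ℤ} {F : Ser K} (h : projLT m F = 0) : GE m F := by
  rw [← projGE_add_projLT m F, h, add_zero]
  exact ge_projGE m F

/-! ### Derivations -/

theorem coeff_dk (φ : LaurentSeries K) (i : ℤ) :
    (dk φ).coeff i = -((i - 1 : ℤ) : K) * φ.coeff (i - 1) := by
  rw [dk, kPow, HahnSeries.coeff_neg, HahnSeries.coeff_single_mul, LaurentSeries.derivative_apply,
    LaurentSeries.hasseDeriv_coeff]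
  have : i - - -2 + ((1 : ℕ) : ℤ) = i - 1 := by push_cast; ring
  rw [this]
  simp only [Ring.choose_one_right, zsmul_eq_mul, one_mul, neg_mul]

theorem dk_add (φ ψ : LaurentSeries K) : dk (φ + ψ) = dk φ + dk ψ := by
  simp only [dk, map_add, mul_add, neg_add]

theorem dk_mul (φ ψ : LaurentSeries K) : dk (φ * ψ) = φ * dk ψ + dk φ * ψ := by
  -- the Euler operator `X d/dX = -k d/dk`; unlike `dk` it does not move supports
  let θ : LaurentSeries K → LaurentSeries K := fun φ => -(kPow K 1 * dk φ)
  have cθ : ∀ φ i, (θ φ).coeff i = (i : K) * φ.coeff i := by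
    intro φ i
    simp only [θ, kPow, HahnSeries.coeff_neg, HahnSeries.coeff_single_mul, coeff_dk]
    have : i - -1 - 1 = i := by ring
    rw [this]
    ring
  have dkθ : ∀ φ, dk φ = -(kPow K (-1) * θ φ) := by
    intro φ
    simp only [θ, kPow, mul_neg, neg_neg, ← mul_assoc, HahnSeries.single_mul_single]
    simp
  have sθ : ∀ φ, (θ φ).support ⊆ φ.support := by
    intro φ i hi
    rw [HahnSeries.mem_support, cθ] at hi
    exact right_ne_zero_of_mul hi
  have key : θ (φ * ψ) = φ * θ ψ + θ φ * ψ := by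
    ext i
    rw [cθ, HahnSeries.coeff_add, HahnSeries.coeff_mul,
      HahnSeries.coeff_mul_right' ψ.isPWO_support (sθ ψ),
      HahnSeries.coeff_mul_left' φ.isPWO_support (sθ φ), Finset.mul_sum, ← Finset.sum_add_distrib]
    refine Finset.sum_congr rfl fun q hq => ?_
    have hq' : q.1 + q.2 = i := by simpa using ((Finset.mem_antidiagonal).1 hq).2.2
    rw [cθ, cθ, ← hq']
    push_cast
    ring
  rw [dkθ (φ * ψ), key, dkθ φ, dkθ ψ]
  ring

theorem coeff_Dk {σ : Type*} (F : MvPowerSeries σ (LaurentSeries K)) (α : σ →₀ ℕ) :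
    MvPowerSeries.coeff α (Dk F) = dk (MvPowerSeries.coeff α F) := rfl

theorem kc_Dk {σ : Type*} (F : MvPowerSeries σ (LaurentSeries K)) (α : σ →₀ ℕ) (j : ℤ) :
    kc α j (Dk F) = ((j + 1 : ℤ) : K) * kc α (j + 1) F := by
  rw [kc_apply, coeff_Dk, coeff_dk, kc_apply, neg_add]
  push_cast
  ring_nf

theorem dk_zero : dk (0 : LaurentSeries K) = 0 := by simp [dk]

/-- A derivation of a commutative ring: an additive map satisfying the Leibniz rule. -/
structure Der (A : Type*) [CommRing A] extends A →+ A where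
  leibniz' : ∀ F G, toFun (F * G) = F * toFun G + G * toFun F

namespace Der

variable {A : Type*} [CommRing A]

instance : FunLike (Der A) A A where
  coe δ := δ.toFun
  coe_injective δ δ' h := by
    rcases δ with ⟨δ, _⟩
    rcases δ' with ⟨δ', _⟩
    congr 1
    exact DFunLike.coe_injective h

instance : AddMonoidHomClass (Der A) A A where
  map_add δ := δ.map_add'
  map_zero δ := δ.map_zero'

variable (δ : Der A)

theorem leibniz (F G : A) : δ (F * G) = F * δ G + G * δ F := δ.leibniz' F G

theorem map_one : δ 1 = 0 := by
  have h := δ.leibniz 1 1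
  simpa using h

theorem map_natCast (n : ℕ) : δ n = 0 := by
  induction n with
  | zero => simp
  | succ n ih => rw [Nat.cast_succ, map_add, ih, δ.map_one, add_zero]

theorem leibniz_pow (F : A) (n : ℕ) : δ (F ^ n) = n * F ^ (n - 1) * δ F := by
  induction n with
  | zero => simp [δ.map_one]
  | succ n ih =>
    rw [pow_succ, δ.leibniz, ih]
    rcases n with _ | n
    · simp
    · simp only [Nat.add_sub_cancel]
      push_cast
      ring

end Der

/-- `∂/∂k` as a derivation. -/
def DkDer (σ : Type*) (K : Type*) [Field K] : Der (MvPowerSeries σ (LaurentSeries K)) where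
  toFun := Dk
  map_zero' := by
    ext1 α
    rw [coeff_Dk, map_zero, dk_zero]
  map_add' F G := by
    ext1 α
    rw [coeff_Dk, map_add, dk_add, map_add, coeff_Dk, coeff_Dk]
  leibniz' F G := by
    classical
    ext1 α
    let dkHom : LaurentSeries K →+ LaurentSeries K := ⟨⟨dk, dk_zero⟩, dk_add⟩
    change dkHom (MvPowerSeries.coeff α (F * G)) =
      MvPowerSeries.coeff α (F * Dk G + G * Dk F)
    rw [map_add, mul_comm G, MvPowerSeries.coeff_mul,
      MvPowerSeries.coeff_mul, MvPowerSeries.coeff_mul, map_sum, ← Finset.sum_add_distrib]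
    exact Finset.sum_congr rfl fun p _ => dk_mul _ _

theorem DkDer_apply {σ : Type*} (F : MvPowerSeries σ (LaurentSeries K)) :
    DkDer σ K F = Dk F := rfl

/-- `∂/∂w` as a derivation. -/
def DDer (w : Var) : Der (Ser K) where
  toFun := D w
  map_zero' := map_zero (MvPowerSeries.pderiv (LaurentSeries K) w)
  map_add' := map_add (MvPowerSeries.pderiv (LaurentSeries K) w)
  leibniz' := (MvPowerSeries.pderiv (LaurentSeries K) w).leibniz

theorem DDer_apply (w : Var) (F : Ser K) : DDer w F = D w F := rfl

theorem kc_D (w : Var) (F : Ser K) (α : Var →₀ ℕ) (j : ℤ) :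
    kc α j (D w F) = ((α w : K) + 1) * kc (α + Finsupp.single w 1) j F := by
  rw [kc_apply, D, MvPowerSeries.coeff_pderiv, kc_apply, mul_comm]
  have : ((α w : LaurentSeries K) + 1) = HahnSeries.C ((α w : K) + 1) := by
    rw [map_add, map_natCast, map_one]
  rw [this, HahnSeries.C_mul_eq_smul, HahnSeries.coeff_smul, smul_eq_mul]

theorem D_D (w w' : Var) (F : Ser K) : D w (D w' F) = D w' (D w F) := by
  rcases eq_or_ne w w' with rfl | h
  · rfl
  refine ext_kc fun α j => ?_
  simp only [kc_D, Finsupp.add_apply, Finsupp.single_eq_of_ne h, Finsupp.single_eq_of_ne h.symm,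
    add_right_comm α (Finsupp.single w 1), add_zero]
  ring

theorem Dk_D (w : Var) (F : Ser K) : Dk (D w F) = D w (Dk F) := by
  refine ext_kc fun α j => ?_
  simp only [kc_D, kc_Dk]
  ring

theorem Supp.D {A : Set ℤ} {F : Ser K} (w : Var) (h : Supp A F) : Supp A (D w F) := by
  intro α j hj
  rw [kc_D] at hj
  exact h _ _ (right_ne_zero_of_mul hj)

theorem Deg.Dk {m : ℤ} {F : Ser K} (h : Deg m F) : Deg (m - 1) (Dk F) := by
  intro α j hj
  rw [kc_Dk] at hj
  have : j + 1 ≤ m := h _ _ (right_ne_zero_of_mul hj)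
  simp only [Set.mem_Iic]
  omega

/-- `∂/∂k` of a polynomial in `k` is a polynomial in `k`. -/
theorem GE.Dk {F : Ser K} (h : GE 0 F) : GE 0 (Dk F) := by
  intro α j hj
  rw [kc_Dk] at hj
  have h1 : 0 ≤ j + 1 := h _ _ (right_ne_zero_of_mul hj)
  have h2 : j + 1 ≠ 0 := fun h => left_ne_zero_of_mul hj (by rw [h, Int.cast_zero])
  simp only [Set.mem_Ici]
  omega

/-- In characteristic zero, a series with vanishing `∂/∂k` only has a `k ^ 0` part. -/
theorem supp_of_Dk_eq_zero [CharZero K] {F : Ser K} (h : Dk F = 0) : Supp {0} F := by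
  intro α j hj
  by_contra hj0
  have h1 : kc α (j - 1) (DMKP.Dk F) = 0 := by rw [h, map_zero]
  rw [kc_Dk, sub_add_cancel] at h1
  exact (mul_ne_zero (Int.cast_ne_zero.2 hj0) hj) h1

theorem D_emb (w : Var) (a : Coef K) : D w (emb a) = emb (MvPowerSeries.pderiv K w a) := by
  refine ext_kc fun α j => ?_
  rw [kc_D, kc_emb, kc_emb, MvPowerSeries.coeff_pderiv]
  split_ifs <;> ring

theorem D_k (w : Var) (i : ℤ) : D w (k K i) = 0 := MvPowerSeries.pderiv_C

theorem D_scal (w : Var) (a : K) : D w (scal a) = 0 := MvPowerSeries.pderiv_C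

theorem Dk_eq_zero {F : Ser K} (h : Supp {0} F) : Dk F = 0 := by
  refine ext_kc fun α j => ?_
  rw [kc_Dk, map_zero]
  by_contra hne
  have : j + 1 = 0 := h _ _ (right_ne_zero_of_mul hne)
  exact left_ne_zero_of_mul hne (by rw [this, Int.cast_zero])

theorem Dk_emb (a : Coef K) : Dk (emb a) = 0 := Dk_eq_zero (supp_emb a)

theorem Dk_scal (a : K) : Dk (scal a : Ser K) = 0 := Dk_eq_zero (supp_scal a)

theorem Dk_k (i : ℤ) : Dk (k K i) = i * k K (i - 1) := by
  classical
  refine ext_kc fun α j => ?_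
  have h : (i : Ser K) * k K (i - 1) = scal (i : K) * k K (i - 1) := by rw [scal_intCast]
  rw [kc_Dk, h, scal_eq_emb, kc_emb_mul_k, kc_k, MvPowerSeries.coeff_C]
  by_cases hα : α = 0
  · by_cases hj : j + 1 = i
    · subst hj
      simp [hα]
    · have : ¬ j = i - 1 := by omega
      simp [hα, hj, this]
  · simp [hα]

/-! ### Infinite sums -/

open Filter Topology in
/-- A family of Laurent series in `k⁻¹` tends to zero if for each `m` almost all its members have
degree at most `m` in `k`. -/
theorem tendsto_laurent_zero {ι : Type*} {φ : ι → LaurentSeries K}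
    (h : ∀ m : ℤ, {i | ∃ n < m, (φ i).coeff n ≠ 0}.Finite) : Tendsto φ cofinite (𝓝 0) := by
  rw [(Valued.hasBasis_nhds_zero (LaurentSeries K) (WithZero (Multiplicative ℤ))).tendsto_right_iff]
  intro γ _
  set e := MonoidWithZeroHom.ValueGroup₀.embedding
    (γ : MonoidWithZeroHom.ValueGroup₀ (.ofClass
      (Valued.v : Valuation (LaurentSeries K) (WithZero (Multiplicative ℤ))))) with he
  have he0 : e ≠ 0 := by
    rw [he, Ne, map_eq_zero]
    exact γ.ne_zero
  refine ((h (1 - WithZero.log e)).subset ?_)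
  intro i hi
  by_contra hcon
  refine hi ?_
  have h1 : ∀ n : ℤ, n < 1 - WithZero.log e → (φ i).coeff n = 0 := by
    intro n hn
    by_contra hne
    exact hcon ⟨n, hn, hne⟩
  have h2 := (LaurentSeries.valuation_le_iff_coeff_lt_eq_zero K).2 h1
  simp only [Set.mem_ofPred_eq]
  rw [Valuation.restrict_lt_iff_lt_embedding]
  refine lt_of_le_of_lt h2 ?_
  change _ < e
  rw [← WithZero.log_lt_log WithZero.exp_ne_zero he0, WithZero.log_exp]
  omega

instance : NonarchimedeanAddGroup (LaurentSeries K) where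
  is_nonarchimedean U hU := by
    obtain ⟨γ, hγ⟩ := Valued.mem_nhds_zero.1 hU
    refine ⟨⟨Valued.v.restrict.ltAddSubgroup γ, AddSubgroup.isOpen_of_mem_nhds _ (g := 0) ?_⟩, hγ⟩
    exact Valued.mem_nhds_zero.2 ⟨γ, fun _ h => h⟩

/-- `d/dk` raises the order in `k⁻¹`; this is what makes it continuous. -/
theorem dk_valuation_le (φ : LaurentSeries K) :
    (Valued.v (dk φ) : WithZero (Multiplicative ℤ)) ≤ Valued.v φ := by
  by_cases h : (Valued.v φ : WithZero (Multiplicative ℤ)) = 0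
  · rw [(Valuation.zero_iff _).1 h, dk_zero]
  · rw [LaurentSeries.valuation_le_iff_coeff_lt_log_eq_zero K h]
    intro n hn
    rw [coeff_dk, (LaurentSeries.valuation_le_iff_coeff_lt_log_eq_zero K h).1 le_rfl (n - 1)
      (by omega), mul_zero]

theorem continuous_dk : Continuous (dk : LaurentSeries K → LaurentSeries K) := by
  let dkHom : LaurentSeries K →+ LaurentSeries K := ⟨⟨dk, dk_zero⟩, dk_add⟩
  refine continuous_of_continuousAt_zero dkHom ?_
  have hb := Valued.hasBasis_nhds_zero (LaurentSeries K) (WithZero (Multiplicative ℤ))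
  rw [ContinuousAt, map_zero, hb.tendsto_iff hb]
  intro γ _
  refine ⟨γ, trivial, fun φ hφ => ?_⟩
  simp only [Set.mem_ofPred_eq] at hφ ⊢
  rw [Valuation.restrict_lt_iff_lt_embedding] at hφ ⊢
  exact lt_of_le_of_lt (dk_valuation_le φ) hφ

theorem continuous_Dk {σ : Type*} :
    Continuous (Dk : MvPowerSeries σ (LaurentSeries K) → MvPowerSeries σ (LaurentSeries K)) :=
  continuous_pi fun α => continuous_dk.comp (MvPowerSeries.WithPiTopology.continuous_coeff _ α)

theorem continuous_D (w : Var) : Continuous (D w : Ser K → Ser K) :=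
  continuous_pi fun α =>
    (MvPowerSeries.WithPiTopology.continuous_coeff (LaurentSeries K)
      (α + Finsupp.single w 1)).mul continuous_const

theorem summable_of_finite {ι : Type*} {F : ι → Ser K}
    (h : ∀ α (m : ℤ), {i | ∃ j > m, kc α j (F i) ≠ 0}.Finite) : Summable F := by
  rw [MvPowerSeries.WithPiTopology.summable_iff_summable_coeff]
  intro α
  refine NonarchimedeanAddGroup.summable_of_tendsto_cofinite_zero (tendsto_laurent_zero fun m => ?_)
  refine (h α (-m)).subset ?_
  rintro i ⟨n, hn, hne⟩
  exact ⟨-n, by omega, by rwa [kc_apply, neg_neg]⟩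

/-- A criterion for summability uniform in the power series variables. -/
theorem summable_of_deg {ι : Type*} {F : ι → Ser K} (h : ∀ m : ℤ, {i | ¬ Deg m (F i)}.Finite) :
    Summable F := by
  refine summable_of_finite fun α m => (h m).subset ?_
  rintro i ⟨j, hj, hne⟩ hd
  have : j ≤ m := hd α j hne
  omega

theorem summable_of_deg_neg {ι : Type*} {F : ι → Ser K} (d : ι → ℕ)
    (hd : ∀ n, {i | d i ≤ n}.Finite) (h : ∀ i, Deg (-(d i : ℤ)) (F i)) : Summable F := by
  refine summable_of_deg fun m => (hd (-m).toNat).subset fun i hi => ?_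
  by_contra hcon
  simp only [Set.mem_ofPred_eq, not_le] at hcon
  exact hi ((h i).mono (by omega))

theorem finite_pnat_le (n : ℕ) : {i : ℕ+ | (i : ℕ) ≤ n}.Finite :=
  Set.Finite.of_finite_image (f := fun i : ℕ+ => (i : ℕ)) ((Set.finite_Iic n).subset
    (by rintro _ ⟨i, hi, rfl⟩; exact hi)) (fun _ _ _ _ h => PNat.coe_injective h)

/-- Taking a coefficient is continuous for the discrete topology on `K`, so each coefficient of an
infinite sum is the one of a suitable partial sum. -/
theorem exists_kc_tsum {ι : Type*} {F : ι → Ser K} (hF : Summable F) (α : Var →₀ ℕ) (j : ℤ) :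
    ∃ s : Finset ι, kc α j (∑' i, F i) = ∑ i ∈ s, kc α j (F i) := by
  let _ : UniformSpace K := ⊥
  have : DiscreteTopology K := ⟨rfl⟩
  have h1 := (MvPowerSeries.WithPiTopology.hasSum_iff_hasSum_coeff.1 hF.hasSum) α
  have h2 := ((LaurentSeries.uniformContinuous_coeff (K := K) (-j)).continuous.tendsto _).comp h1
  obtain ⟨s, hs⟩ := (h2.eventually (eventually_nhds_iff.2
    ⟨{_}, fun x hx => hx, isOpen_discrete _, rfl⟩)).exists
  refine ⟨s, ?_⟩
  rw [kc_apply, ← Set.mem_singleton_iff.1 hs]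
  simp only [Function.comp_apply, HahnSeries.coeff_sum, kc_apply]

/-- Summability is not needed: otherwise the sum has the value `0`. -/
theorem Supp.tsum {ι : Type*} {A : Set ℤ} {F : ι → Ser K} (h : ∀ i, Supp A (F i)) :
    Supp A (∑' i, F i) := by
  by_cases hF : Summable F
  · intro α j hj
    obtain ⟨s, hs⟩ := exists_kc_tsum hF α j
    rw [hs] at hj
    obtain ⟨i, _, hi⟩ := Finset.exists_ne_zero_of_sum_ne_zero hj
    exact h i α j hi
  · rw [tsum_eq_zero_of_not_summable hF]
    exact Supp.zero A

/-- The properties shared by `∂/∂k`, `∂/∂x`, `∂/∂s` and `∂/∂tₙ`: such a derivation is continuous,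
does not raise degrees in `k`, kills constants, and lowers the order of vanishing in the deviations
by at most one. -/
structure IsPartial (δ : Der (Ser K)) : Prop where
  continuous : Continuous δ
  deg : ∀ {m : ℤ} {F : Ser K}, Deg m F → Deg m (δ F)
  scal : ∀ a : K, δ (scal a) = 0
  order : ∀ (n : ℕ) (F : Ser K), (∀ α : Var →₀ ℕ, α.degree < n + 1 → MvPowerSeries.coeff α F = 0) →
    ∀ α : Var →₀ ℕ, α.degree < n → MvPowerSeries.coeff α (δ F) = 0

theorem isPartial_Dk : IsPartial (DkDer Var K) where
  continuous := continuous_Dk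
  deg h := (Deg.Dk h).mono (by omega)
  scal := Dk_scal
  order n F h α hα := by rw [DkDer_apply, coeff_Dk, h α (by omega), dk_zero]

theorem isPartial_D (w : Var) : IsPartial (DDer (K := K) w) where
  continuous := continuous_D w
  deg h := Supp.D w h
  scal := D_scal w
  order n F h α hα := by
    rw [DDer_apply, D, MvPowerSeries.coeff_pderiv, h _ (by simpa using hα), zero_mul]

theorem IsPartial.map_tsum {δ : Der (Ser K)} (hδ : IsPartial δ) {ι : Type*} {F : ι → Ser K}
    (hF : Summable F) : δ (∑' i, F i) = ∑' i, δ (F i) :=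
  ((hF.hasSum.map (δ : Der (Ser K)) hδ.continuous).tsum_eq).symm

theorem IsPartial.summable {δ : Der (Ser K)} (hδ : IsPartial δ) {ι : Type*} {F : ι → Ser K}
    (hF : Summable F) : Summable (fun i => δ (F i)) :=
  hF.map (δ : Der (Ser K)) hδ.continuous

theorem IsPartial.scal_mul {δ : Der (Ser K)} (hδ : IsPartial δ) (a : K) (F : Ser K) :
    δ (DMKP.scal a * F) = DMKP.scal a * δ F := by
  rw [δ.leibniz, hδ.scal, mul_zero, add_zero]

/-! ### Inverses -/

/-- Inversion by a geometric series: the inverse of a series `k ^ m + (lower powers)` is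
`k ^ (-m) + (lower powers)`. -/
theorem inv_of_leading {m : ℤ} {F : Ser K} (h : Deg (m - 1) (F - k K m)) :
    F * F⁻¹ = 1 ∧ Deg (-m - 1) (F⁻¹ - k K (-m)) := by
  set ε := 1 - k K (-m) * F with hε
  have hkk : k K (-m) * k K m = 1 := by rw [← k_add, neg_add_cancel, k_zero]
  have hεd : Deg (-1) ε := by
    have : ε = -(k K (-m) * (F - k K m)) := by rw [hε, mul_sub, hkk]; ring
    rw [this]
    exact (((deg_k _).mul h).mono (by omega)).neg
  have hs : Summable (fun n : ℕ => ε ^ n) :=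
    summable_of_deg_neg id (fun n => Set.finite_Iic n) fun n => (hεd.pow n).mono (by simp)
  have hs1 : Summable (fun n : ℕ => ε ^ (n + 1)) := (summable_nat_add_iff 1).2 hs
  set G := ∑' n : ℕ, ε ^ n with hG
  have hG1 : G = 1 + ∑' n : ℕ, ε ^ (n + 1) := by rw [hG, hs.tsum_eq_zero_add, pow_zero]
  have hG2 : G = 1 + ε * G := by
    rw [hG1]
    congr 1
    rw [← hG1, hG, ← hs.tsum_mul_left]
    exact tsum_congr fun n => pow_succ' ε n
  have hmul : F * (k K (-m) * G) = 1 := by linear_combination hG2 + G * hε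
  have hne : MvPowerSeries.constantCoeff F ≠ 0 := by
    intro h0
    have := congrArg MvPowerSeries.constantCoeff hmul
    rw [map_mul, h0, zero_mul, map_one] at this
    exact zero_ne_one this
  have hinv : F⁻¹ = k K (-m) * G := by
    rw [MvPowerSeries.inv_eq_iff_mul_eq_one hne, mul_comm]
    exact hmul
  refine ⟨by rw [hinv, hmul], ?_⟩
  have : F⁻¹ - k K (-m) = k K (-m) * ∑' n : ℕ, ε ^ (n + 1) := by
    rw [hinv, hG1]; ring
  rw [this]
  refine ((deg_k (-m)).mul (b := -1) (Supp.tsum fun n => ?_)).mono (by omega)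
  exact (hεd.pow (n + 1)).mono (by push_cast; omega)

theorem deg_of_leading {m : ℤ} {F : Ser K} (h : Deg (m - 1) (F - k K m)) : Deg m F := by
  have := (h.mono (by omega)).add (deg_k (K := K) m)
  rwa [sub_add_cancel] at this

/-! ### Integer powers -/

section powers

variable {L : Ser K}

/-- `L` as a unit, so that its integer powers obey the usual rules. -/
def unitOf (h : L * L⁻¹ = 1) : (Ser K)ˣ := ⟨L, L⁻¹, h, by rw [mul_comm, h]⟩

theorem zpow_eq (h : L * L⁻¹ = 1) (j : ℤ) : zpow L j = ((unitOf h ^ j : (Ser K)ˣ) : Ser K) := by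
  cases j with
  | ofNat n => simp [zpow, unitOf]
  | negSucc n => simp [zpow, zpow_negSucc, unitOf, ← inv_pow]

theorem zpow_add' (h : L * L⁻¹ = 1) (i j : ℤ) : zpow L (i + j) = zpow L i * zpow L j := by
  rw [zpow_eq h, zpow_eq h, zpow_eq h, zpow_add, Units.val_mul]

theorem zpow_zero' : zpow L 0 = 1 := pow_zero L

theorem zpow_natCast' (n : ℕ) : zpow L n = L ^ n := rfl

theorem zpow_neg_natCast (h : L * L⁻¹ = 1) (n : ℕ) : zpow L (-(n : ℤ)) = L⁻¹ ^ n := by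
  rw [zpow_eq h, zpow_neg, zpow_natCast, ← inv_pow, Units.val_pow_eq_pow_val]
  rfl

theorem deg_zpow (hL : Deg 1 L) (hL' : Deg (-1) L⁻¹) (j : ℤ) : Deg j (zpow L j) := by
  cases j with
  | ofNat n => exact (hL.pow n).mono (by simp)
  | negSucc n => exact (hL'.pow (n + 1)).mono (by simp [Int.negSucc_eq])

theorem Der.map_inv (δ : Der (Ser K)) (h : L * L⁻¹ = 1) : δ L⁻¹ = -(L⁻¹ ^ 2 * δ L) := by
  have h1 := δ.leibniz L L⁻¹
  rw [h, δ.map_one] at h1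
  linear_combination (-δ L⁻¹) * h - L⁻¹ * h1

theorem Der.map_zpow (δ : Der (Ser K)) (h : L * L⁻¹ = 1) (j : ℤ) :
    δ (zpow L j) = (j : Ser K) * zpow L (j - 1) * δ L := by
  obtain ⟨n, rfl | rfl⟩ := j.eq_nat_or_neg
  · rw [zpow_natCast', δ.leibniz_pow]
    rcases n with _ | n
    · simp
    · have : ((n + 1 : ℕ) : ℤ) - 1 = (n : ℕ) := by push_cast; ring
      rw [this, zpow_natCast', Nat.add_sub_cancel]
      push_cast
      ring
  · rw [zpow_neg_natCast h, δ.leibniz_pow, δ.map_inv h]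
    have : -(n : ℤ) - 1 = -((n + 1 : ℕ) : ℤ) := by push_cast; ring
    rw [this, zpow_neg_natCast h]
    rcases n with _ | n
    · simp
    · simp only [Nat.add_sub_cancel]
      push_cast
      ring

end powers

/-! ### Substitution into Laurent series -/

/-- The coefficients of `φ` below index `n` vanish, i.e. `φ` has degree at most `-n` in `k`. -/
def Low (n : ℤ) (φ : LaurentSeries K) : Prop := ∀ i < n, φ.coeff i = 0

theorem exists_low (φ : LaurentSeries K) : ∃ n, Low n φ :=
  ⟨φ.order, fun _ hi => HahnSeries.coeff_eq_zero_of_lt_order hi⟩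

theorem Low.mul {m n : ℤ} {φ ψ : LaurentSeries K} (hφ : Low m φ) (hψ : Low n ψ) :
    Low (m + n) (φ * ψ) := by
  intro i hi
  rw [HahnSeries.coeff_mul]
  refine Finset.sum_eq_zero fun q hq => ?_
  have hq' : q.1 + q.2 = i := by simpa using ((Finset.mem_antidiagonal).1 hq).2.2
  by_cases h : q.1 < m
  · rw [hφ _ h, zero_mul]
  · rw [hψ _ (by omega), mul_zero]

theorem Low.dk {n : ℤ} {φ : LaurentSeries K} (h : Low n φ) : Low n (dk φ) := by
  intro i hi
  rw [coeff_dk, h _ (by omega), mul_zero]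

/-- An additive map on Laurent series which raises degrees by at most a fixed amount is determined
by its values on monomials. -/
theorem laurent_dense (T : LaurentSeries K →+ Ser K) (C : ℤ)
    (h1 : ∀ n a, T (HahnSeries.single n a) = 0)
    (h2 : ∀ n φ, Low n φ → Deg (C - n) (T φ)) (φ : LaurentSeries K) : T φ = 0 := by
  refine eq_zero_of_forall_deg fun m => ?_
  obtain ⟨o, ho⟩ := exists_low φ
  let ψ : LaurentSeries K := ∑ i ∈ Finset.Ico o (C - m), HahnSeries.single i (φ.coeff i)
  have hψ : T ψ = 0 := by
    rw [map_sum]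
    exact Finset.sum_eq_zero fun i _ => h1 _ _
  have hlow : Low (C - m) (φ - ψ) := by
    intro i hi
    rw [HahnSeries.coeff_sub, HahnSeries.coeff_sum]
    simp only [HahnSeries.coeff_single]
    by_cases hio : i < o
    · rw [ho i hio, zero_sub, neg_eq_zero]
      refine Finset.sum_eq_zero fun j hj => ?_
      rw [if_neg]
      rintro rfl
      exact absurd (Finset.mem_Ico.1 hj).1 (by omega)
    · rw [sub_eq_zero]
      exact ((Finset.sum_eq_single i (fun j _ hj => if_neg hj.symm)
        (fun h => absurd (Finset.mem_Ico.2 ⟨by omega, hi⟩) h)).trans (if_pos rfl)).symm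
  have h := h2 _ _ hlow
  rw [map_sub, hψ, sub_zero] at h
  exact h.mono (by omega)

theorem evalL_single {L : Ser K} (n : ℤ) (a : K) :
    evalL (HahnSeries.single n a) L = scal a * zpow L (-n) := by
  rw [evalL, tsum_eq_single (-n)]
  · rw [neg_neg, HahnSeries.coeff_single_same]
  · intro j hj
    rw [HahnSeries.coeff_single_of_ne (by omega), scal_zero, zero_mul]

section evalL

variable {L : Ser K} (hL : Deg 0 (L - k K 1))

include hL

theorem mul_inv_L : L * L⁻¹ = 1 := (inv_of_leading (m := 1) hL).1

theorem deg_L : Deg 1 L := deg_of_leading (m := 1) hL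

theorem deg_inv_L : Deg (-1) L⁻¹ := deg_of_leading (inv_of_leading (m := 1) hL).2

theorem summable_evalL (φ : LaurentSeries K) :
    Summable fun j : ℤ => scal (φ.coeff (-j)) * zpow L j := by
  obtain ⟨o, ho⟩ := exists_low φ
  refine summable_of_deg fun m => (Set.finite_Icc m (-o)).subset fun j hj => ?_
  refine ⟨?_, ?_⟩ <;> by_contra hcon <;> refine hj ?_
  · exact ((deg_zpow (deg_L hL) (deg_inv_L hL) j).mono (by omega)).scal_mul _
  · rw [ho _ (by omega), scal_zero, zero_mul]
    exact Supp.zero _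

theorem deg_evalL {n : ℤ} {φ : LaurentSeries K} (h : Low n φ) : Deg (-n) (evalL φ L) := by
  refine Supp.tsum fun j => ?_
  by_cases hj : -j < n
  · rw [h _ hj, scal_zero, zero_mul]
    exact Supp.zero _
  · exact ((deg_zpow (deg_L hL) (deg_inv_L hL) j).mono (by omega)).scal_mul _

/-- `φ ↦ φ(𝓛)` as an additive map. -/
def evalLAdd : LaurentSeries K →+ Ser K where
  toFun φ := evalL φ L
  map_zero' := by simp [evalL, scal_zero]
  map_add' φ ψ := by
    rw [evalL, evalL, evalL, ← (summable_evalL hL φ).tsum_add (summable_evalL hL ψ)]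
    exact tsum_congr fun j => by rw [HahnSeries.coeff_add, scal_add, add_mul]

theorem evalL_mul (φ ψ : LaurentSeries K) : evalL (φ * ψ) L = evalL φ L * evalL ψ L := by
  -- the defect of multiplicativity; being symmetric, it vanishes if it does on pairs of monomials
  let T : LaurentSeries K → LaurentSeries K →+ Ser K := fun ψ =>
    (evalLAdd hL).comp (AddMonoidHom.mulRight ψ) - (AddMonoidHom.mulRight (evalL ψ L)).comp
      (evalLAdd hL)
  have hT : ∀ φ ψ, T ψ φ = evalL (φ * ψ) L - evalL φ L * evalL ψ L := fun _ _ => rfl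
  have hTc : ∀ φ ψ, T ψ φ = T φ ψ := fun φ ψ => by rw [hT, hT, mul_comm φ, mul_comm (evalL φ L)]
  have hlow : ∀ ψ, ∃ C : ℤ, ∀ n φ, Low n φ → Deg (C - n) (T ψ φ) := by
    intro ψ
    obtain ⟨o, ho⟩ := exists_low ψ
    refine ⟨-o, fun n φ h => ?_⟩
    rw [hT]
    exact ((deg_evalL hL (h.mul ho)).mono (by omega)).sub
      (((deg_evalL hL h).mul (deg_evalL hL ho)).mono (by omega))
  have h1 : ∀ n a ψ, T ψ (HahnSeries.single n a) = 0 := by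
    intro n a ψ
    rw [hTc]
    obtain ⟨C, hC⟩ := hlow (HahnSeries.single n a)
    refine laurent_dense _ C (fun m b => ?_) hC ψ
    rw [hT, HahnSeries.single_mul_single, evalL_single, evalL_single, evalL_single, neg_add,
      zpow_add' (mul_inv_L hL), DMKP.scal_mul]
    ring
  obtain ⟨C, hC⟩ := hlow ψ
  have := laurent_dense (T ψ) C (fun n a => h1 n a ψ) hC φ
  rwa [hT, sub_eq_zero] at this

/-- `φ ↦ φ(𝓛)` as a ring homomorphism. -/
def evalLHom : LaurentSeries K →+* Ser K :=
  { evalLAdd hL with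
    map_one' := by
      change evalL (HahnSeries.single 0 1) L = 1
      rw [evalL_single, scal_one, neg_zero, zpow_zero', one_mul]
    map_mul' := evalL_mul hL }

theorem evalLHom_apply (φ : LaurentSeries K) : evalLHom hL φ = evalL φ L := rfl

/-- The chain rule `δ(φ(𝓛)) = φ'(𝓛) δ𝓛`. -/
theorem map_evalL {δ : Der (Ser K)} (hδ : IsPartial δ) (φ : LaurentSeries K) :
    δ (evalL φ L) = evalL (dk φ) L * δ L := by
  let dkHom : LaurentSeries K →+ LaurentSeries K := ⟨⟨dk, dk_zero⟩, dk_add⟩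
  let T : LaurentSeries K →+ Ser K := δ.toAddMonoidHom.comp (evalLAdd hL) -
    (AddMonoidHom.mulRight (δ L)).comp ((evalLAdd hL).comp dkHom)
  have hT : ∀ φ, T φ = δ (evalL φ L) - evalL (dk φ) L * δ L := fun _ => rfl
  have := laurent_dense T 1 (fun n a => ?_) (fun n φ h => ?_) φ
  · rwa [hT, sub_eq_zero] at this
  · have hdk : dk (HahnSeries.single n a) = HahnSeries.single (n + 1) (-(n : K) * a) := by
      ext i
      rw [coeff_dk, HahnSeries.coeff_single, HahnSeries.coeff_single]
      by_cases hi : i = n + 1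
      · subst hi
        simp
      · rw [if_neg (by omega), if_neg hi, mul_zero]
    have hn : -n - 1 = -(n + 1) := by ring
    rw [hT, hdk, evalL_single, evalL_single, hδ.scal_mul, δ.map_zpow (mul_inv_L hL),
      DMKP.scal_mul, scal_neg, scal_intCast, hn]
    push_cast
    ring
  · rw [hT]
    exact ((hδ.deg (deg_evalL hL h)).mono (by omega)).sub
      (((deg_evalL hL h.dk).mul (hδ.deg (deg_L hL))).mono (by omega))

end evalL

/-! ### Substitution into twistor functions -/

/-- The power series `F` has no monomials of total degree less than `n`. -/
def Ord {σ : Type*} (n : ℕ) (F : MvPowerSeries σ (LaurentSeries K)) : Prop :=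
  ∀ α : σ →₀ ℕ, α.degree < n → MvPowerSeries.coeff α F = 0

theorem ord_iff {σ : Type*} {n : ℕ} {F : MvPowerSeries σ (LaurentSeries K)} :
    Ord n F ↔ (n : ℕ∞) ≤ F.order :=
  ⟨fun h => MvPowerSeries.nat_le_order h, fun h _ hα =>
    MvPowerSeries.coeff_of_lt_order (lt_of_lt_of_le (by exact_mod_cast hα) h)⟩

theorem Ord.mul {σ : Type*} {m n : ℕ} {F G : MvPowerSeries σ (LaurentSeries K)}
    (hF : Ord m F) (hG : Ord n G) : Ord (m + n) (F * G) := by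
  rw [ord_iff] at *
  push_cast
  exact (add_le_add hF hG).trans MvPowerSeries.le_order_mul

theorem ord_zero {σ : Type*} (F : MvPowerSeries σ (LaurentSeries K)) : Ord 0 F :=
  fun _ h => absurd h (Nat.not_lt_zero _)

theorem Ord.mul_left {σ : Type*} {n : ℕ} (F : MvPowerSeries σ (LaurentSeries K))
    {G : MvPowerSeries σ (LaurentSeries K)} (hG : Ord n G) : Ord n (F * G) := by
  simpa using (ord_zero F).mul hG

theorem Ord.mono {σ : Type*} {m n : ℕ} {F : MvPowerSeries σ (LaurentSeries K)} (h : Ord n F)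
    (hmn : m ≤ n) : Ord m F := fun α hα => h α (by omega)

theorem Ord.sub {σ : Type*} {n : ℕ} {F G : MvPowerSeries σ (LaurentSeries K)}
    (hF : Ord n F) (hG : Ord n G) : Ord n (F - G) := fun α hα => by
  rw [map_sub, hF α hα, hG α hα, sub_zero]

theorem Ord.pow {σ : Type*} {F : MvPowerSeries σ (LaurentSeries K)}
    (h : MvPowerSeries.constantCoeff F = 0) (n : ℕ) : Ord n (F ^ n) :=
  ord_iff.2 (MvPowerSeries.le_order_pow_of_constantCoeff_eq_zero n h)

theorem Ord.tsum {ι : Type*} {n : ℕ} {F : ι → Ser K} (h : ∀ i, Ord n (F i)) :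
    Ord n (∑' i, F i) := by
  by_cases hF : Summable F
  · intro α hα
    have h1 := (MvPowerSeries.WithPiTopology.hasSum_iff_hasSum_coeff.1 hF.hasSum) α
    have h2 : (fun i => MvPowerSeries.coeff α (F i)) = fun _ => 0 := funext fun i => h i α hα
    rw [h2] at h1
    exact h1.unique hasSum_zero
  · rw [tsum_eq_zero_of_not_summable hF]
    exact fun α _ => map_zero _

instance : Fintype GVar := ⟨⟨[GVar.x, GVar.s], by simp⟩, by rintro (_ | _) <;> simp⟩

theorem degree_gvar (d : GVar →₀ ℕ) : d.degree = d .x + d .s := by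
  rw [Finsupp.degree_eq_sum]
  change d .x + (d .s + 0) = _
  rw [add_zero]

/-- An additive map on twistor functions which lowers the order of vanishing by at most a fixed
amount is determined by its values on monomials. -/
theorem germ_dense (T : Germ K →+ Ser K)
    (h1 : ∀ d a, T (MvPowerSeries.monomial d a) = 0)
    (h2 : ∀ n f, Ord (n + 1) f → Ord n (T f)) (f : Germ K) : T f = 0 := by
  classical
  ext1 α
  rw [map_zero]
  let s := (Finsupp.finite_of_degree_le (σ := GVar) (α.degree + 1)).toFinset
  let p : Germ K := ∑ d ∈ s, MvPowerSeries.monomial d (MvPowerSeries.coeff d f)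
  have hp : T p = 0 := by
    rw [map_sum]
    exact Finset.sum_eq_zero fun d _ => h1 _ _
  have ho : Ord (α.degree + 1 + 1) (f - p) := by
    intro d hd
    rw [map_sub, map_sum]
    simp only [MvPowerSeries.coeff_monomial]
    rw [Finset.sum_ite_eq, if_pos, sub_self]
    rw [Set.Finite.mem_toFinset, Set.mem_ofPred_eq]
    omega
  have h := h2 _ _ ho α (by omega)
  rwa [map_sub, hp, sub_zero] at h

section evalG

variable {L M : Ser K} {c : LaurentSeries K} (hL : Deg 0 (L - k K 1))
  (hc : MvPowerSeries.constantCoeff M = MvPowerSeries.constantCoeff (evalL c L))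

/-- The summand of `f(𝓛, 𝓜, s)` belonging to the monomial `d`. -/
def germTerm (c : LaurentSeries K) (f : Germ K) (L M : Ser K) (d : GVar →₀ ℕ) : Ser K :=
  evalL (MvPowerSeries.coeff d f) L * (M - evalL c L) ^ d .x * MvPowerSeries.X .s ^ d .s

include hc in
theorem ord_germTerm (f : Germ K) (d : GVar →₀ ℕ) : Ord d.degree (germTerm c f L M d) := by
  rw [degree_gvar]
  refine (Ord.mul_left _ (Ord.pow ?_ _)).mul (Ord.pow (MvPowerSeries.constantCoeff_X _) _)
  rw [map_sub, hc, sub_self]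

include hc in
theorem summable_germTerm (f : Germ K) : Summable (germTerm c f L M) := by
  refine summable_of_finite fun α m =>
    (Finsupp.finite_of_degree_le (σ := GVar) α.degree).subset ?_
  rintro d ⟨j, _, hne⟩
  by_contra hd
  refine hne ?_
  rw [kc_apply, ord_germTerm hc f d α (by simpa using hd), HahnSeries.coeff_zero]

include hL hc in
theorem ord_eval {n : ℕ} {f : Germ K} (h : Ord n f) : Ord n (f.eval c L M) := by
  refine Ord.tsum fun d => ?_
  by_cases hd : d.degree < n
  · rw [h d hd, ← evalLHom_apply hL, map_zero, zero_mul, zero_mul]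
    exact fun α _ => map_zero _
  · exact (ord_germTerm hc f d).mono (by omega)

/-- `f ↦ f(𝓛, 𝓜, s)` as an additive map. -/
def evalAdd : Germ K →+ Ser K where
  toFun f := f.eval c L M
  map_zero' := by
    simp only [Germ.eval, map_zero]
    simp only [← evalLHom_apply hL, map_zero, zero_mul, tsum_zero]
  map_add' f g := by
    refine Eq.trans (tsum_congr fun d => ?_)
      ((summable_germTerm hc f).tsum_add (summable_germTerm hc g))
    simp only [germTerm, map_add, ← evalLHom_apply hL, add_mul]

include hL in
theorem eval_monomial (d : GVar →₀ ℕ) (a : LaurentSeries K) :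
    Germ.eval c (MvPowerSeries.monomial d a) L M =
      evalL a L * (M - evalL c L) ^ d .x * MvPowerSeries.X .s ^ d .s := by
  classical
  rw [Germ.eval, tsum_eq_single d]
  · rw [MvPowerSeries.coeff_monomial_same]
  · intro e he
    rw [MvPowerSeries.coeff_monomial_ne he, ← evalLHom_apply hL, map_zero, zero_mul, zero_mul]

include hL hc in
theorem eval_mul (f g : Germ K) :
    (f * g).eval c L M = f.eval c L M * g.eval c L M := by
  let T : Germ K → Germ K →+ Ser K := fun g =>
    (evalAdd hL hc).comp (AddMonoidHom.mulRight g) -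
      (AddMonoidHom.mulRight (g.eval c L M)).comp (evalAdd hL hc)
  have hT : ∀ f g : Germ K, T g f = (f * g).eval c L M - f.eval c L M * g.eval c L M :=
    fun _ _ => rfl
  have hTc : ∀ f g, T g f = T f g := fun f g => by
    rw [hT, hT, mul_comm f, mul_comm (Germ.eval c f L M)]
  have hord : ∀ g n f, Ord (n + 1) f → Ord n (T g f) := by
    intro g n f h
    rw [hT, mul_comm f, mul_comm (Germ.eval c f L M)]
    exact ((ord_eval hL hc (h.mul_left g)).sub ((ord_eval hL hc h).mul_left _)).mono (by omega)
  have h1 : ∀ d a g, T g (MvPowerSeries.monomial d a) = 0 := by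
    intro d a g
    rw [hTc]
    refine germ_dense _ (fun e b => ?_) (hord _) g
    rw [hT, MvPowerSeries.monomial_mul_monomial, eval_monomial hL, eval_monomial hL,
      eval_monomial hL, evalL_mul hL, Finsupp.add_apply, Finsupp.add_apply, pow_add, pow_add]
    ring
  have := germ_dense (T g) (fun d a => h1 d a g) (hord g) f
  rwa [hT, sub_eq_zero] at this

/-- `f ↦ f(𝓛, 𝓜, s)` as a ring homomorphism. -/
def evalHom : Germ K →+* Ser K :=
  { evalAdd hL hc with
    map_one' := by
      change Germ.eval c (MvPowerSeries.monomial 0 1) L M = 1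
      rw [eval_monomial hL, ← evalLHom_apply hL]
      simp
    map_mul' := eval_mul hL hc }

include hL in
theorem eval_C (a : LaurentSeries K) :
    Germ.eval c (MvPowerSeries.C a) L M = evalL a L := by
  have := eval_monomial (M := M) (c := c) hL 0 a
  simpa using this

include hL in
theorem eval_X_x : Germ.eval c (MvPowerSeries.X .x) L M = M - evalL c L := by
  rw [MvPowerSeries.X, eval_monomial hL, ← evalLHom_apply hL, map_one]
  simp

include hL in
theorem eval_X_s : Germ.eval c (MvPowerSeries.X .s) L M = MvPowerSeries.X .s := by
  rw [MvPowerSeries.X, eval_monomial hL, ← evalLHom_apply hL, map_one]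
  simp [MvPowerSeries.X]

include hL hc in
/-- The chain rule for `f(𝓛, 𝓜, s)`. -/
theorem map_eval {δ : Der (Ser K)} (hδ : IsPartial δ) (f : Germ K) :
    δ (f.eval c L M) = (f.dk c).eval c L M * δ L + f.dx.eval c L M * δ M
      + f.ds.eval c L M * δ (MvPowerSeries.X .s) := by
  let E := evalHom hL hc
  let T : Germ K →+ Ser K :=
    { toFun f := δ (E f) - (E (f.dk c) * δ L + E f.dx * δ M + E f.ds * δ (MvPowerSeries.X .s))
      map_zero' := by
        have h : DMKP.Dk (0 : Germ K) = 0 := map_zero (DkDer GVar K)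
        simp [Germ.dk, Germ.dx, Germ.ds, h]
      map_add' f g := by
        have h : DMKP.Dk (f + g) = DMKP.Dk f + DMKP.Dk g := map_add (DkDer GVar K) f g
        simp only [Germ.dk, Germ.dx, Germ.ds, h, map_add, map_sub, map_mul]
        ring }
  have hT : ∀ f, T f = δ (E f) - (E (f.dk c) * δ L + E f.dx * δ M
    + E f.ds * δ (MvPowerSeries.X .s)) := fun _ => rfl
  -- both sides of the chain rule are derivations along `E`
  have hmul : ∀ f g, T f = 0 → T g = 0 → T (f * g) = 0 := by
    intro f g hf hg
    have h : DMKP.Dk (f * g) = f * DMKP.Dk g + g * DMKP.Dk f := (DkDer GVar K).leibniz f g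
    rw [hT] at *
    simp only [Germ.dk, Germ.dx, Germ.ds, h, map_add, map_sub, map_mul, Derivation.leibniz,
      smul_eq_mul, δ.leibniz] at hf hg ⊢
    linear_combination E f * hg + E g * hf
  have hDkC : ∀ a : LaurentSeries K, DMKP.Dk (MvPowerSeries.C a : Germ K)
      = MvPowerSeries.C (DMKP.dk a) := by
    classical
    intro a
    ext1 α
    rw [coeff_Dk, MvPowerSeries.coeff_C, MvPowerSeries.coeff_C]
    split_ifs
    · rfl
    · exact dk_zero
  have hdk1 : DMKP.dk (1 : LaurentSeries K) = 0 := by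
    have := dk_mul (1 : LaurentSeries K) 1
    simpa using this
  have hDkX : ∀ w, DMKP.Dk (MvPowerSeries.X w : Germ K) = 0 := by
    classical
    intro w
    ext1 α
    rw [coeff_Dk, MvPowerSeries.coeff_X, map_zero]
    split_ifs
    · exact hdk1
    · exact dk_zero
  have hEC : ∀ a, E (MvPowerSeries.C a) = evalL a L := fun a => eval_C hL a
  have hC : ∀ a, T (MvPowerSeries.C a) = 0 := by
    intro a
    rw [hT, Germ.dk, Germ.dx, Germ.ds, MvPowerSeries.pderiv_C, MvPowerSeries.pderiv_C, hDkC,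
      mul_zero, sub_zero, hEC, hEC, map_zero, map_evalL hL hδ]
    ring
  have hEx : E (MvPowerSeries.X .x) = M - evalL c L := eval_X_x hL
  have hEs : E (MvPowerSeries.X .s) = MvPowerSeries.X .s := eval_X_s hL
  have hx : T (MvPowerSeries.X .x) = 0 := by
    rw [hT, Germ.dk, Germ.dx, Germ.ds, MvPowerSeries.pderiv_X_self,
      MvPowerSeries.pderiv_X_of_ne (by simp), hDkX, hEx, mul_one, zero_sub, map_neg, map_one,
      map_zero, hEC, map_sub, map_evalL hL hδ]
    ring
  have hs : T (MvPowerSeries.X .s) = 0 := by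
    rw [hT, Germ.dk, Germ.dx, Germ.ds, MvPowerSeries.pderiv_X_self,
      MvPowerSeries.pderiv_X_of_ne (by simp), hDkX, hEs, mul_zero, sub_zero, map_one, map_zero]
    ring
  have hone : T 1 = 0 := by
    rw [← map_one (MvPowerSeries.C (σ := GVar) (R := LaurentSeries K))]
    exact hC 1
  have hpow : ∀ f n, T f = 0 → T (f ^ n) = 0 := by
    intro f n hf
    induction n with
    | zero => rw [pow_zero, hone]
    | succ n ih => rw [pow_succ, hmul _ _ ih hf]
  have hmon : ∀ d a, T (MvPowerSeries.monomial d a) = 0 := by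
    intro d a
    have hd : MvPowerSeries.monomial d a = MvPowerSeries.C a * MvPowerSeries.X GVar.x ^ d .x
        * MvPowerSeries.X GVar.s ^ d .s := by
      rw [MvPowerSeries.X_pow_eq, MvPowerSeries.X_pow_eq, ← MvPowerSeries.monomial_zero_eq_C_apply,
        MvPowerSeries.monomial_mul_monomial, MvPowerSeries.monomial_mul_monomial]
      congr 1
      · congr 1
        ext (_ | _) <;> simp
      · simp
    rw [hd]
    exact hmul _ _ (hmul _ _ (hC a) (hpow _ _ hx)) (hpow _ _ hs)
  have hordd : ∀ n (w : GVar) (f : Germ K), Ord (n + 1) f →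
      Ord n (MvPowerSeries.pderiv (LaurentSeries K) w f) := by
    intro n w f h α hα
    rw [MvPowerSeries.coeff_pderiv, h _ (by simpa using hα), zero_mul]
  have hordk : ∀ n (f : Germ K), Ord (n + 1) f → Ord n (f.dk c) := by
    intro n f h
    refine Ord.sub (fun α hα => ?_) ((hordd n .x f h).mul_left _)
    rw [coeff_Dk, h _ (by omega), dk_zero]
  have key := germ_dense T hmon (fun n (f : Germ K) h => ?_) f
  · rw [hT, sub_eq_zero] at key
    exact key
  · have hE : ∀ {n f}, Ord n f → Ord n (E f) := fun h => ord_eval hL hc h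
    have hdx : Ord n f.dx := hordd n .x f h
    have hds : Ord n f.ds := hordd n .s f h
    intro α hα
    rw [hT, map_sub, map_add, map_add, hδ.order n _ (hE h) α hα,
      mul_comm (E (f.dk c)), mul_comm (E f.dx), mul_comm (E f.ds),
      (hE (hordk n f h)).mul_left _ α hα, (hE hdx).mul_left _ α hα,
      (hE hds).mul_left _ α hα]
    simp

end evalG

/-! ### Leading terms -/

theorem leading_mul {a b : ℤ} {F G : Ser K} (hF : Deg (a - 1) (F - k K a))
    (hG : Deg (b - 1) (G - k K b)) : Deg (a + b - 1) (F * G - k K (a + b)) := by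
  have : F * G - k K (a + b) = (F - k K a) * G + k K a * (G - k K b) := by
    rw [k_add]; ring
  rw [this]
  exact ((hF.mul (deg_of_leading hG)).mono (by omega)).add
    (((deg_k a).mul hG).mono (by omega))

theorem leading_pow {F : Ser K} (hF : Deg 0 (F - k K 1)) (n : ℕ) :
    Deg (n - 1) (F ^ n - k K n) := by
  induction n with
  | zero =>
    rw [Nat.cast_zero, k_zero, pow_zero, sub_self]
    exact Supp.zero _
  | succ n ih =>
    have h := leading_mul (a := n) (b := 1) ih hF
    rw [← pow_succ] at h
    exact_mod_cast h

theorem leading_calL (u : ℕ+ → Coef K) : Deg (-1) (calL u - k K 1) := by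
  rw [calL, add_sub_cancel_left]
  refine Supp.tsum fun n => ((deg_emb _).mul (deg_k _)).mono ?_
  have := n.pos
  omega

theorem leading_calP (N : ℕ) (p : Fin N → Coef K) : Deg ((N : ℤ) - 1) (calP N p - k K N) := by
  rw [calP, add_sub_cancel_left]
  refine Supp.sum _ fun i _ => ((deg_emb _).mul (deg_k _)).mono ?_
  have := i.isLt
  omega

theorem Deg.Dk_leading {m : ℤ} {F : Ser K} {i : ℤ} (h : Deg m (F - k K i)) :
    Deg (m - 1) (DMKP.Dk F - (i : Ser K) * k K (i - 1)) := by
  have h1 : DMKP.Dk (F - k K i) = DMKP.Dk F - DMKP.Dk (k K i) := map_sub (DkDer Var K) F _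
  rw [← Dk_k, ← h1]
  exact h.Dk

theorem Deg.D_leading {m : ℤ} {F : Ser K} {i : ℤ} (w : Var) (h : Deg m (F - k K i)) :
    Deg m (D w F) := by
  have h1 : D w (F - k K i) = D w F - D w (k K i) := map_sub (DDer w) F _
  rw [D_k, sub_zero] at h1
  rw [← h1]
  exact Supp.D w h

theorem kc_mul_k (α : Var →₀ ℕ) (F : Ser K) (i j : ℤ) :
    kc α j (F * k K i) = kc α (j - i) F := by
  rw [kc_apply, k, MvPowerSeries.coeff_mul_C, kPow, HahnSeries.coeff_mul_single, mul_one, kc_apply]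
  congr 1
  ring

theorem kc_natCast_mul (α : Var →₀ ℕ) (F : Ser K) (n : ℕ) (j : ℤ) :
    kc α j ((n : Ser K) * F) = n * kc α j F := by
  rw [← nsmul_eq_mul, map_nsmul, nsmul_eq_mul]

/-- A solution of `∂R/∂k = V R`, where `V = N k⁻¹ + ⋯`, has leading power `k ^ N` unless it
vanishes. -/
theorem eq_zero_of_logDeriv [CharZero K] {N : ℕ} {R V : Ser K} (hR : Deg ((N : ℤ) - 1) R)
    (hV : Deg (-2) (V - (N : Ser K) * k K (-1))) (h : Dk R = R * V) : R = 0 := by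
  -- comparing the coefficients of `k ^ (j - 1)` gives `(j - N) r_j = 0`
  have step : ∀ j < (N : ℤ), Deg j R → Deg (j - 1) R := by
    intro j hj hd α i hi
    have hij : i ≤ j := hd α i hi
    rw [Set.mem_Iic]
    by_contra hcon
    obtain rfl : i = j := by omega
    have h1 := congrArg (kc α (i - 1)) h
    have h2 : R * V = R * (V - (N : Ser K) * k K (-1)) + (N : Ser K) * (R * k K (-1)) := by ring
    have h3 : kc α (i - 1) (R * (V - (N : Ser K) * k K (-1))) = 0 := by
      by_contra hne
      have h4 : i - 1 ≤ i + -2 := (hd.mul hV) α (i - 1) hne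
      omega
    rw [kc_Dk, h2, map_add, h3, kc_natCast_mul, kc_mul_k, zero_add, sub_neg_eq_add,
      sub_add_cancel] at h1
    have h5 : (((i - N : ℤ)) : K) * kc α i R = 0 := by
      push_cast
      linear_combination h1
    refine mul_ne_zero (Int.cast_ne_zero.2 ?_) hi h5
    omega
  refine eq_zero_of_forall_deg fun m => ?_
  have hn : ∀ n : ℕ, Deg ((N : ℤ) - 1 - n) R := by
    intro n
    induction n with
    | zero => simpa using hR
    | succ n ih => exact (step _ (by omega) ih).mono (by push_cast; omega)
  exact (hn ((N : ℤ) - 1 - m).toNat).mono (by omega)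

/-! ### Derivatives of the Orlov function -/

/-- `∑ (δ vₙ) 𝓛^{-n-1}`, the part of `δ𝓜` that comes from the coefficients `vₙ`. -/
def tail (L : Ser K) (v : ℕ+ → Coef K) (δ : Der (Ser K)) : Ser K :=
  ∑' n : ℕ+, δ (emb (v n)) * L⁻¹ ^ ((n : ℕ) + 1)

/-- Multiples of the functions `tₙ` are always summable: almost all base values `t⁰ₙ` vanish, and
each monomial contains only finitely many of the deviations. -/
theorem summable_tVar_mul (b : BasePoint K) (G : ℕ+ → Ser K) :
    Summable fun n => b.tVar n * G n := by
  have h1 : Summable fun n => scal (b.t n) * G n := by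
    refine summable_of_finite fun α m => b.t.support.finite_toSet.subset ?_
    rintro n ⟨j, _, hne⟩
    rw [Finset.mem_coe, Finsupp.mem_support_iff]
    intro h0
    rw [h0, scal_zero, zero_mul, map_zero] at hne
    exact hne rfl
  have h2 : Summable fun n => MvPowerSeries.X (.t n) * G n := by
    refine summable_of_finite fun α m =>
      (α.support.finite_toSet.preimage (f := Var.t) (fun _ _ _ _ h => Var.t.inj h)).subset ?_
    rintro n ⟨j, _, hne⟩
    rw [Set.mem_preimage, Finset.mem_coe, Finsupp.mem_support_iff]
    intro h0
    rw [kc_apply, MvPowerSeries.X_dvd_iff.1 (dvd_mul_right _ _) α h0, HahnSeries.coeff_zero] at hne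
    exact hne rfl
  refine (h1.add h2).congr fun n => ?_
  rw [BasePoint.tVar, add_mul]

section

variable {L : Ser K} (hL : Deg 0 (L - k K 1))
include hL

theorem deg_inv_pow (n : ℕ) : Deg (-(n : ℤ)) (L⁻¹ ^ n) :=
  ((deg_inv_L hL).pow n).mono (by omega)

theorem summable_mul_inv_pow (F : ℕ+ → Ser K) (hF : ∀ n, Deg 0 (F n)) (i : ℕ) :
    Summable fun n : ℕ+ => F n * L⁻¹ ^ ((n : ℕ) + i) :=
  summable_of_deg_neg (fun n : ℕ+ => (n : ℕ)) finite_pnat_le fun n =>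
    ((hF n).mul (deg_inv_pow hL _)).mono (by push_cast; omega)

theorem deg_tail {δ : Der (Ser K)} (hδ : IsPartial δ) (v : ℕ+ → Coef K) :
    Deg (-2) (tail L v δ) :=
  Supp.tsum fun n => ((hδ.deg (deg_emb (v n))).mul (deg_inv_pow hL _)).mono (by
    have := n.pos
    push_cast
    omega)

/-- `∂𝓜/∂𝓛` at fixed `t`, `x`, `s` and `vₙ`. -/
def dML (N : ℕ) (b : BasePoint K) (L : Ser K) (v : ℕ+ → Coef K) : Ser K :=
  ∑' n : ℕ+, b.tVar n * (((n : ℕ) : Ser K) * (((n : ℕ) - 1 : ℕ) : Ser K) * L ^ ((n : ℕ) - 1 - 1))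
    - (N : Ser K) * b.sVar * L⁻¹ ^ 2
    - ∑' n : ℕ+, emb (v n) * ((n : ℕ) + 1 : ℕ) * L⁻¹ ^ ((n : ℕ) + 2)

/-- Every partial derivative of `𝓜` is the sum of its part through `𝓛` and its explicit part. -/
theorem map_calM {δ : Der (Ser K)} (hδ : IsPartial δ) (N : ℕ) (b : BasePoint K)
    (v : ℕ+ → Coef K) :
    δ (calM N b L v) = dML N b L v * δ L
      + (∑' n : ℕ+, δ (b.tVar n) * (((n : ℕ) : Ser K) * L ^ ((n : ℕ) - 1))
        + δ b.xVar + N * δ b.sVar * L⁻¹ + tail L v δ) := by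
  have hi := mul_inv_L hL
  have s1 : Summable fun n : ℕ+ => ((n : ℕ) : Ser K) * b.tVar n * L ^ ((n : ℕ) - 1) :=
    (summable_tVar_mul b fun n => ((n : ℕ) : Ser K) * L ^ ((n : ℕ) - 1)).congr fun n => by ring
  have s2 := summable_tVar_mul b fun n =>
    ((n : ℕ) : Ser K) * (((n : ℕ) - 1 : ℕ) : Ser K) * L ^ ((n : ℕ) - 1 - 1)
  have e1 : ∀ n : ℕ+, δ (((n : ℕ) : Ser K) * b.tVar n * L ^ ((n : ℕ) - 1)) =
      b.tVar n * (((n : ℕ) : Ser K) * (((n : ℕ) - 1 : ℕ) : Ser K) * L ^ ((n : ℕ) - 1 - 1)) * δ L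
      + δ (b.tVar n) * (((n : ℕ) : Ser K) * L ^ ((n : ℕ) - 1)) := by
    intro n
    rw [δ.leibniz, δ.leibniz, δ.map_natCast, δ.leibniz_pow]
    ring
  have s3 : Summable fun n : ℕ+ => δ (b.tVar n) * (((n : ℕ) : Ser K) * L ^ ((n : ℕ) - 1)) :=
    ((hδ.summable s1).sub (s2.mul_right (δ L))).congr fun n => by rw [e1]; ring
  have s4 := summable_mul_inv_pow hL (fun n => emb (v n)) (fun n => deg_emb _) 1
  have s5 := summable_mul_inv_pow hL (fun n : ℕ+ => emb (v n) * ((n : ℕ) + 1 : ℕ))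
    (fun n => by simpa using (deg_emb (v n)).mul (deg_natCast ((n : ℕ) + 1))) 2
  have s6 := summable_mul_inv_pow hL (fun n => δ (emb (v n))) (fun n => hδ.deg (deg_emb _)) 1
  have e2 : ∀ n : ℕ+, δ (emb (v n) * L⁻¹ ^ ((n : ℕ) + 1)) =
      δ (emb (v n)) * L⁻¹ ^ ((n : ℕ) + 1)
        - emb (v n) * ((n : ℕ) + 1 : ℕ) * L⁻¹ ^ ((n : ℕ) + 2) * δ L := by
    intro n
    rw [δ.leibniz, δ.leibniz_pow, δ.map_inv hi, Nat.add_sub_cancel]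
    ring
  rw [calM, map_add, map_add, map_add, hδ.map_tsum s1, hδ.map_tsum s4, tsum_congr e1,
    tsum_congr e2, (s2.mul_right (δ L)).tsum_add s3, s6.tsum_sub (s5.mul_right (δ L)),
    s2.tsum_mul_right, s5.tsum_mul_right, δ.leibniz, δ.leibniz, δ.map_natCast, δ.map_inv hi, dML,
    tail]
  ring

end

theorem D_X_self (w : Var) : D w (MvPowerSeries.X w : Ser K) = 1 := MvPowerSeries.pderiv_X_self

theorem D_X_of_ne {w w' : Var} (h : w' ≠ w) : D w (MvPowerSeries.X w' : Ser K) = 0 :=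
  MvPowerSeries.pderiv_X_of_ne h

theorem D_scal_add (w : Var) (a : K) (F : Ser K) : D w (scal a + F) = D w F := by
  have h : D w (scal a + F) = D w (scal a) + D w F := map_add (DDer w) _ _
  rw [h, D_scal, zero_add]

theorem supp_X (w : Var) : Supp {0} (MvPowerSeries.X w : Ser K) := by
  have : (MvPowerSeries.X w : Ser K) = emb (MvPowerSeries.X w) := by
    rw [emb, MvPowerSeries.map_X]
  rw [this]
  exact supp_emb _

/-! ### The exponential formula -/

theorem pnat_inv_mul_cancel [CharZero K] (n : ℕ+) :
    (((n : ℕ) : K)⁻¹) * ((n : ℕ) : K) = 1 :=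
  inv_mul_cancel₀ (Nat.cast_ne_zero.2 n.ne_zero)

theorem summable_exp {E : Ser K} (hE : Deg (-1) E) (a : ℕ → K) :
    Summable fun m : ℕ => scal (a m) * E ^ m :=
  summable_of_deg_neg id (fun n => Set.finite_Iic n) fun n =>
    ((hE.pow n).mono (by simp)).scal_mul _

theorem leading_expSer {E : Ser K} (hE : Deg (-1) E) : Deg (-1) (expSer E - k K 0) := by
  have hs := summable_exp hE fun m => ((m.factorial : K)⁻¹)
  rw [expSer, hs.tsum_eq_zero_add, Nat.factorial_zero, Nat.cast_one, inv_one, scal_one, pow_zero,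
    one_mul, k_zero, add_sub_cancel_left]
  exact Supp.tsum fun n => ((hE.pow (n + 1)).mono (by push_cast; omega)).scal_mul _

/-- The chain rule `δ(exp E) = exp E · δE`. -/
theorem map_expSer [CharZero K] {δ : Der (Ser K)} (hδ : IsPartial δ) {E : Ser K}
    (hE : Deg (-1) E) : δ (expSer E) = expSer E * δ E := by
  have hs := summable_exp hE fun m => ((m.factorial : K)⁻¹)
  rw [expSer, hδ.map_tsum hs, (hδ.summable hs).tsum_eq_zero_add, pow_zero, hδ.scal_mul,
    δ.map_one, mul_zero, zero_add, ← hs.tsum_mul_right]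
  refine tsum_congr fun m => ?_
  have h1 : (((m + 1).factorial : K)⁻¹) * ((m + 1 : ℕ) : K) = (m.factorial : K)⁻¹ := by
    have h2 : ((m + 1 : ℕ) : K) ≠ 0 := Nat.cast_ne_zero.2 (Nat.succ_ne_zero m)
    have h3 : (m.factorial : K) ≠ 0 := Nat.cast_ne_zero.2 m.factorial_ne_zero
    rw [Nat.factorial_succ]
    push_cast at h2 ⊢
    field_simp
  rw [hδ.scal_mul, δ.leibniz_pow, Nat.add_sub_cancel, ← h1, DMKP.scal_mul, scal_natCast]
  ring

/-! ### Explicit derivatives of `𝓜` and `𝓠` -/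

/-- The exponent in the definition of `𝓠`. -/
def expoQ (L : Ser K) (v : ℕ+ → Coef K) : Ser K :=
  ∑' n : ℕ+, scal (-((n : ℕ) : K)⁻¹) * D .s (emb (v n)) * L⁻¹ ^ (n : ℕ)

section

variable {L : Ser K} (hL : Deg 0 (L - k K 1)) (N : ℕ) (b : BasePoint K) (v : ℕ+ → Coef K)
include hL

theorem Dk_calM : Dk (calM N b L v) = dML N b L v * Dk L := by
  have h := map_calM hL isPartial_Dk N b v
  simp only [DkDer_apply] at h
  have h1 : ∀ n, Dk (b.tVar n) = 0 := fun n => Dk_eq_zero ((supp_scal _).add (supp_X _))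
  have h2 : Dk b.xVar = 0 := Dk_eq_zero ((supp_scal _).add (supp_X _))
  have h3 : Dk b.sVar = 0 := Dk_eq_zero ((supp_scal _).add (supp_X _))
  have h4 : tail L v (DkDer Var K) = 0 := by
    simp only [tail, DkDer_apply, Dk_emb, zero_mul, tsum_zero]
  simpa [h1, h2, h3, h4] using h

theorem D_calM_x : D .x (calM N b L v) = dML N b L v * D .x L + (1 + tail L v (DDer .x)) := by
  have h := map_calM hL (isPartial_D .x) N b v
  simp only [DDer_apply] at h
  have h1 : ∀ n, D .x (b.tVar n) = 0 := fun n => by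
    rw [BasePoint.tVar, D_scal_add, D_X_of_ne (by simp)]
  have h2 : D .x b.xVar = 1 := by rw [BasePoint.xVar, D_scal_add, D_X_self]
  have h3 : D .x b.sVar = 0 := by rw [BasePoint.sVar, D_scal_add, D_X_of_ne (by simp)]
  simpa [h1, h2, h3] using h

theorem D_calM_s : D .s (calM N b L v) =
    dML N b L v * D .s L + ((N : Ser K) * L⁻¹ + tail L v (DDer .s)) := by
  have h := map_calM hL (isPartial_D .s) N b v
  simp only [DDer_apply] at h
  have h1 : ∀ n, D .s (b.tVar n) = 0 := fun n => by
    rw [BasePoint.tVar, D_scal_add, D_X_of_ne (by simp)]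
  have h2 : D .s b.xVar = 0 := by rw [BasePoint.xVar, D_scal_add, D_X_of_ne (by simp)]
  have h3 : D .s b.sVar = 1 := by rw [BasePoint.sVar, D_scal_add, D_X_self]
  simpa [h1, h2, h3] using h

theorem D_calM_t (n : ℕ+) : D (.t n) (calM N b L v) =
    dML N b L v * D (.t n) L
      + (((n : ℕ) : Ser K) * L ^ ((n : ℕ) - 1) + tail L v (DDer (.t n))) := by
  have h := map_calM hL (isPartial_D (.t n)) N b v
  simp only [DDer_apply] at h
  have h1 : ∀ m, m ≠ n → D (.t n) (b.tVar m) = 0 := fun m hm => by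
    rw [BasePoint.tVar, D_scal_add, D_X_of_ne (by simpa using hm)]
  have h1' : D (.t n) (b.tVar n) = 1 := by rw [BasePoint.tVar, D_scal_add, D_X_self]
  have h2 : D (.t n) b.xVar = 0 := by rw [BasePoint.xVar, D_scal_add, D_X_of_ne (by simp)]
  have h3 : D (.t n) b.sVar = 0 := by rw [BasePoint.sVar, D_scal_add, D_X_of_ne (by simp)]
  rw [tsum_eq_single n (fun m hm => by rw [h1 m hm, zero_mul]), h1', one_mul, h2, h3, mul_zero,
    zero_mul, add_zero, add_zero] at h
  exact h

theorem deg_expoQ : Deg (-1) (expoQ L v) :=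
  Supp.tsum fun n => ((Deg.scal_mul _ ((deg_emb (v n)).D .s)).mul (deg_inv_pow hL _)).mono (by
    have := n.pos
    omega)

theorem leading_calQ : Deg ((N : ℤ) - 1) (calQ N L v - k K N) := by
  have h := leading_mul (leading_pow hL N) (leading_expSer (deg_expoQ hL v))
  rwa [add_zero] at h

/-- The logarithmic derivative of `𝓠` in `k`. -/
theorem Dk_calQ [CharZero K] (hN : 1 ≤ N) : Dk (calQ N L v) =
    calQ N L v * (((N : Ser K) * L⁻¹ + tail L v (DDer .s)) * Dk L) := by
  have hi := mul_inv_L hL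
  have hs : Summable fun n : ℕ+ => scal (-((n : ℕ) : K)⁻¹) * D .s (emb (v n)) * L⁻¹ ^ (n : ℕ) :=
    summable_mul_inv_pow hL (fun n : ℕ+ => scal (-((n : ℕ) : K)⁻¹) * D .s (emb (v n)))
      (fun n => Deg.scal_mul _ ((deg_emb (v n)).D .s)) 0
  have hs' := summable_mul_inv_pow hL (fun n => DDer .s (emb (v n)))
    (fun n => (deg_emb (v n)).D .s) 1
  have hE : Dk (expoQ L v) = tail L v (DDer .s) * Dk L := by
    have h1 := isPartial_Dk.map_tsum hs
    rw [DkDer_apply] at h1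
    rw [expoQ, h1, tail, ← hs'.tsum_mul_right]
    refine tsum_congr fun n => ?_
    have h0 : DkDer Var K (D .s (emb (v n))) = 0 := by
      rw [DkDer_apply, D_emb, Dk_emb]
    have hn : scal (-((n : ℕ) : K)⁻¹) * ((n : ℕ) : Ser K) = -1 := by
      rw [← scal_natCast, ← DMKP.scal_mul, neg_mul, pnat_inv_mul_cancel, scal_neg, scal_one]
    obtain ⟨m, hm⟩ : ∃ m, (n : ℕ) = m + 1 := ⟨(n : ℕ) - 1, by have := n.pos; omega⟩
    rw [mul_assoc, isPartial_Dk.scal_mul, Der.leibniz, h0, Der.leibniz_pow, Der.map_inv _ hi,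
      DkDer_apply, DDer_apply]
    rw [hm] at hn ⊢
    rw [Nat.add_sub_cancel]
    linear_combination (-D .s (emb (v n)) * L⁻¹ ^ (m + 1 + 1) * Dk L) * hn
  have h2 : Dk (calQ N L v) = L ^ N * Dk (expSer (expoQ L v)) + expSer (expoQ L v) * Dk (L ^ N) :=
    (DkDer Var K).leibniz _ _
  have h3 : Dk (expSer (expoQ L v)) = expSer (expoQ L v) * Dk (expoQ L v) :=
    map_expSer isPartial_Dk (deg_expoQ hL v)
  have h4 : Dk (L ^ N) = (N : Ser K) * L ^ (N - 1) * Dk L := (DkDer Var K).leibniz_pow _ _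
  obtain ⟨m, rfl⟩ : ∃ m, N = m + 1 := ⟨N - 1, by omega⟩
  have h5 : calQ (m + 1) L v = L ^ (m + 1) * expSer (expoQ L v) := rfl
  rw [h2, h3, h4, hE, h5, Nat.add_sub_cancel]
  linear_combination (-((m + 1 : ℕ) : Ser K) * L ^ m * expSer (expoQ L v) * Dk L) * hi

end

/-! ### Differential-algebraic identities -/

theorem Dk_mul (F G : Ser K) : Dk (F * G) = F * Dk G + G * Dk F := (DkDer Var K).leibniz F G
theorem Dk_add (F G : Ser K) : Dk (F + G) = Dk F + Dk G := map_add (DkDer Var K) F G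
theorem Dk_sub (F G : Ser K) : Dk (F - G) = Dk F - Dk G := map_sub (DkDer Var K) F G
theorem D_mul (w : Var) (F G : Ser K) : D w (F * G) = F * D w G + G * D w F :=
  (DDer w).leibniz F G
theorem D_add (w : Var) (F G : Ser K) : D w (F + G) = D w F + D w G := map_add (DDer w) F G
theorem D_sub (w : Var) (F G : Ser K) : D w (F - G) = D w F - D w G := map_sub (DDer w) F G

/-- The logarithmic derivatives of an invertible series are closed. -/
theorem Dk_logD {P : Ser K} (h : P * P⁻¹ = 1) (w : Var) :
    Dk (D w P * P⁻¹) = D w (Dk P * P⁻¹) := by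
  have h1 : Dk P⁻¹ = -(P⁻¹ ^ 2 * Dk P) := (DkDer Var K).map_inv h
  have h2 : D w P⁻¹ = -(P⁻¹ ^ 2 * D w P) := (DDer w).map_inv h
  rw [Dk_mul, D_mul, h1, h2, Dk_D]
  ring

theorem D_logD {P : Ser K} (h : P * P⁻¹ = 1) (w w' : Var) :
    D w (D w' P * P⁻¹) = D w' (D w P * P⁻¹) := by
  have h1 : D w P⁻¹ = -(P⁻¹ ^ 2 * D w P) := (DDer w).map_inv h
  have h2 : D w' P⁻¹ = -(P⁻¹ ^ 2 * D w' P) := (DDer w').map_inv h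
  rw [D_mul, D_mul, h1, h2, D_D]
  ring

/-- Compatibility of the flows `∂F/∂s = {log P, F}` and `∂F/∂w = {B, F}`: the function `F`
commutes with the curvature `∂B/∂s - ∂ log P/∂w - {log P, B}`. -/
theorem poisson_curvature {P B F : Ser K} (hP : P * P⁻¹ = 1) (w : Var)
    (hs : D .s F = Dk P * P⁻¹ * D .x F - D .x P * P⁻¹ * Dk F)
    (hw : D w F = Dk B * D .x F - D .x B * Dk F) :
    poisson (D .s B - D w P * P⁻¹ + Dk B * (D .x P * P⁻¹) - D .x B * (Dk P * P⁻¹)) F = 0 := by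
  have c1 := Dk_logD hP w
  have c2 := D_logD hP .x w
  have c3 := Dk_logD hP .x
  generalize D w P * P⁻¹ = aw at *
  generalize D .x P * P⁻¹ = ax at *
  generalize Dk P * P⁻¹ = ak at *
  have e1 := congrArg (D w) hs
  have e2 := congrArg (D .s) hw
  have e3 := congrArg Dk hs
  have e4 := congrArg (D .x) hs
  have e5 := congrArg Dk hw
  have e6 := congrArg (D .x) hw
  simp only [poisson, Dk_add, Dk_sub, Dk_mul, D_add, D_sub, D_mul] at *
  rw [D_D w .s F, ← Dk_D w F, D_D w .x F] at e1
  rw [← Dk_D .s F, ← Dk_D .s B, D_D .s .x F, D_D .s .x B] at e2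
  rw [← Dk_D .x B, ← Dk_D .x F] at *
  rw [c1, c2, c3]
  linear_combination e1 - e2 + ak * e6 - ax * e5 - Dk B * e4 + D .x B * e3
    - D .x B * Dk F * c3

/-- A function that commutes with a canonical pair does not depend on `k`. -/
theorem Dk_eq_zero_of_poisson {L M H : Ser K} (hLM : poisson L M = 1) (h1 : poisson H L = 0)
    (h2 : poisson H M = 0) : Dk H = 0 := by
  rw [poisson] at *
  linear_combination (-Dk H) * hLM + Dk L * h2 - Dk M * h1

theorem leading_inv {m : ℤ} {F : Ser K} (h : Deg (m - 1) (F - k K m)) : Deg (-m) F⁻¹ :=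
  deg_of_leading (inv_of_leading h).2

theorem GE.D {m : ℤ} {F : Ser K} (w : Var) (h : GE m F) : GE m (D w F) := Supp.D w h
theorem Deg.D {m : ℤ} {F : Ser K} (w : Var) (h : Deg m F) : Deg m (D w F) := Supp.D w h

theorem GE.polynomial_mul {m : ℤ} {F G : Ser K} (hF : GE 0 F) (hG : GE m G) : GE m (F * G) := by
  simpa using GE.mul hF hG

/-! ### From the twistor data to the hierarchy -/

section hierarchy

variable {L M P ML Lh Mh fk fx fs gk gx gs Vx Vs : Ser K} {Vt : ℕ+ → Ser K} {N : ℕ}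

/-- Everything about `𝓛`, `𝓜`, `𝓟` and the twistor functions that the derivation of the hierarchy
uses: the leading powers, the chain rules for `𝓜` and for `𝓛̂ = f(𝓛, 𝓜, s)`, `𝓜̂ = g(𝓛, 𝓜, s)`,
and the conditions on `𝓛̂` and `𝓜̂`. Here `ML` stands for `∂𝓜/∂𝓛`, the series `fk`, `fx`, `fs`,
`gk`, `gx`, `gs` for the partial derivatives of `f` and `g` evaluated at `(𝓛, 𝓜, s)`, and `Vx`,
`Vs`, `Vt n` for the contributions of the coefficients `vₙ` to the derivatives of `𝓜`. -/
structure TwistorData (N : ℕ) (L M P ML Lh Mh fk fx fs gk gx gs Vx Vs : Ser K)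
    (Vt : ℕ+ → Ser K) : Prop where
  L_lead : Deg (-1) (L - k K 1)
  P_lead : Deg ((N : ℤ) - 1) (P - k K N)
  Vx_deg : Deg (-2) Vx
  Vs_deg : Deg (-2) Vs
  Vt_deg : ∀ n, Deg (-2) (Vt n)
  Dk_M : Dk M = ML * Dk L
  Dx_M : D .x M = ML * D .x L + (1 + Vx)
  Ds_M : D .s M = ML * D .s L + ((N : Ser K) * L⁻¹ + Vs)
  Dt_M : ∀ n : ℕ+, D (.t n) M =
    ML * D (.t n) L + (((n : ℕ) : Ser K) * L ^ ((n : ℕ) - 1) + Vt n)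
  det : fk * gx - fx * gk = 1
  Dk_Lh : Dk Lh = fk * Dk L + fx * Dk M
  Dx_Lh : D .x Lh = fk * D .x L + fx * D .x M
  Ds_Lh : D .s Lh = fk * D .s L + fx * D .s M + fs
  Dt_Lh : ∀ n : ℕ+, D (.t n) Lh = fk * D (.t n) L + fx * D (.t n) M
  Dk_Mh : Dk Mh = gk * Dk L + gx * Dk M
  Dx_Mh : D .x Mh = gk * D .x L + gx * D .x M
  Ds_Mh : D .s Mh = gk * D .s L + gx * D .s M + gs
  Dt_Mh : ∀ n : ℕ+, D (.t n) Mh = gk * D (.t n) L + gx * D (.t n) M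
  Lh_ge : GE 0 Lh
  Mh_ge : GE 0 Mh
  Lh_ge' : GE ((N : ℤ) - 1) (P * D .s Lh - poisson P Lh - P * fs)
  Mh_ge' : GE ((N : ℤ) - 1) (P * D .s Mh - poisson P Mh - P * gs)

variable (T : TwistorData N L M P ML Lh Mh fk fx fs gk gx gs Vx Vs Vt)
include T

namespace TwistorData

theorem L_lead' : Deg 0 (L - k K 1) := T.L_lead.mono (by omega)

theorem Dk_L_lead : Deg (-2) (Dk L - 1) := by
  have := T.L_lead.Dk_leading
  rwa [Int.cast_one, one_mul, sub_self, k_zero] at this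

theorem deg_Dk_L : Deg 0 (Dk L) := by
  have := (T.Dk_L_lead.mono (n := 0) (by omega)).add deg_one
  rwa [sub_add_cancel] at this

theorem deg_D_L (w : Var) : Deg (-1) (D w L) := T.L_lead.D_leading w

theorem P_mul_inv : P * P⁻¹ = 1 := (inv_of_leading T.P_lead).1

theorem deg_P_inv : Deg (-(N : ℤ)) P⁻¹ := leading_inv T.P_lead

/-- `{𝓛, 𝓜} = {𝓛̂, 𝓜̂}` is a polynomial in `k`, and its part of degree `≥ 0` is `1`. -/
theorem ccr : poisson L M = 1 := by
  have h1 : poisson L M - 1 = (Dk L - 1) * (1 + Vx) + Vx := by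
    rw [poisson, T.Dk_M, T.Dx_M]; ring
  have h2 : poisson L M = poisson Lh Mh := by
    simp only [poisson, T.Dk_Lh, T.Dx_Lh, T.Dk_Mh, T.Dx_Mh]
    linear_combination (D .x L * Dk M - Dk L * D .x M) * T.det
  have d1 : Deg (-2) (poisson L M - 1) := by
    rw [h1]
    exact ((T.Dk_L_lead.mul (deg_one.add (T.Vx_deg.mono (by omega)))).mono (by omega)).add T.Vx_deg
  have d2 : GE 0 (poisson L M - 1) := by
    rw [h2, poisson]
    exact ((GE.polynomial_mul T.Lh_ge.Dk (T.Mh_ge.D _)).sub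
      (GE.polynomial_mul (T.Lh_ge.D _) T.Mh_ge.Dk)).sub ge_one
  exact sub_eq_zero.1 (eq_zero_of_deg_ge d1 d2 (by omega))

/-- The combinations that determine `∂𝓛/∂tₙ` and `∂𝓜/∂tₙ` are polynomials in `k` because they can
be expressed through `𝓛̂` and `𝓜̂`; so they equal their parts of degree `≥ 0`. -/
theorem flow_k (n : ℕ+) : Dk L * D (.t n) M - Dk M * D (.t n) L = Dk (calB L n) := by
  have hpow : Dk (L ^ (n : ℕ)) = ((n : ℕ) : Ser K) * L ^ ((n : ℕ) - 1) * Dk L :=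
    (DkDer Var K).leibniz_pow _ _
  have hsplit : Dk (L ^ (n : ℕ)) = Dk (calB L n) + Dk (projLT 0 (L ^ (n : ℕ))) := by
    rw [← Dk_add, calB, projGE_add_projLT]
  have h1 : Dk L * D (.t n) M - Dk M * D (.t n) L - Dk (calB L n)
      = Dk (projLT 0 (L ^ (n : ℕ))) + Dk L * Vt n := by
    rw [T.Dt_M, T.Dk_M]
    linear_combination hsplit - hpow
  have h2 : Dk L * D (.t n) M - Dk M * D (.t n) L
      = Dk Lh * D (.t n) Mh - Dk Mh * D (.t n) Lh := by
    rw [T.Dk_Lh, T.Dk_Mh, T.Dt_Lh, T.Dt_Mh]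
    linear_combination (Dk M * D (.t n) L - Dk L * D (.t n) M) * T.det
  refine sub_eq_zero.1 (eq_zero_of_deg_ge (m := -1) (n := 0) ?_ ?_ (by omega))
  · rw [h1]
    exact ((deg_projLT 0 _).Dk.mono (by omega)).add ((T.deg_Dk_L.mul (T.Vt_deg n)).mono (by omega))
  · rw [h2]
    exact ((GE.polynomial_mul T.Lh_ge.Dk (T.Mh_ge.D _)).sub
      (GE.polynomial_mul T.Mh_ge.Dk (T.Lh_ge.D _))).sub (ge_projGE 0 _).Dk

/-- The companion of `flow_k`, by the same argument. -/
theorem flow_x (n : ℕ+) : D .x M * D (.t n) L - D .x L * D (.t n) M = -D .x (calB L n) := by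
  have hpow : D .x (L ^ (n : ℕ)) = ((n : ℕ) : Ser K) * L ^ ((n : ℕ) - 1) * D .x L :=
    (DDer .x).leibniz_pow _ _
  have hsplit : D .x (L ^ (n : ℕ)) = D .x (calB L n) + D .x (projLT 0 (L ^ (n : ℕ))) := by
    rw [← D_add, calB, projGE_add_projLT]
  have h1 : D .x M * D (.t n) L - D .x L * D (.t n) M - -D .x (calB L n)
      = D (.t n) L * (1 + Vx) - D .x L * Vt n - D .x (projLT 0 (L ^ (n : ℕ))) := by
    rw [T.Dt_M, T.Dx_M]
    linear_combination hpow - hsplit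
  have h2 : D .x M * D (.t n) L - D .x L * D (.t n) M
      = D .x Mh * D (.t n) Lh - D .x Lh * D (.t n) Mh := by
    rw [T.Dx_Lh, T.Dx_Mh, T.Dt_Lh, T.Dt_Mh]
    linear_combination (D .x L * D (.t n) M - D .x M * D (.t n) L) * T.det
  refine sub_eq_zero.1 (eq_zero_of_deg_ge (m := -1) (n := 0) ?_ ?_ (by omega))
  · rw [h1]
    exact ((((T.deg_D_L _).mul (deg_one.add (T.Vx_deg.mono (by omega)))).mono (by omega)).sub
      (((T.deg_D_L _).mul (T.Vt_deg n)).mono (by omega))).sub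
      (((deg_projLT 0 _).D _).mono (by omega))
  · rw [h2]
    exact ((GE.polynomial_mul (T.Mh_ge.D _) (T.Lh_ge.D _)).sub
      (GE.polynomial_mul (T.Lh_ge.D _) (T.Mh_ge.D _))).sub ((ge_projGE 0 _).D _).neg

theorem lax_L (n : ℕ+) : D (.t n) L = poisson (calB L n) L := by
  have hc := T.ccr
  rw [poisson] at hc ⊢
  linear_combination Dk L * T.flow_x n + D .x L * T.flow_k n - D (.t n) L * hc

theorem lax_M (n : ℕ+) : D (.t n) M = poisson (calB L n) M := by
  have hc := T.ccr
  rw [poisson] at hc ⊢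
  linear_combination Dk M * T.flow_x n + D .x M * T.flow_k n - D (.t n) M * hc

theorem inv_L_lead : Deg (-2) (L⁻¹ - k K (-1)) := (inv_of_leading (m := 1) T.L_lead').2

/-- `∂𝓛/∂k` times the explicit `s`-derivative of `𝓜` is `N k⁻¹ + ⋯`. -/
theorem W_lead : Deg (-2) (((N : Ser K) * L⁻¹ + Vs) * Dk L - (N : Ser K) * k K (-1)) := by
  have h : ((N : Ser K) * L⁻¹ + Vs) * Dk L - (N : Ser K) * k K (-1)
      = ((N : Ser K) * L⁻¹) * (Dk L - 1) + (N : Ser K) * (L⁻¹ - k K (-1)) + Vs * Dk L := by ring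
  rw [h]
  exact (((((deg_inv_L T.L_lead').natCast_mul N).mul T.Dk_L_lead).mono (by omega)).add
    (T.inv_L_lead.natCast_mul N)).add ((T.Vs_deg.mul T.deg_Dk_L).mono (by omega))

/-- The logarithmic derivative of `𝓟` in `k` is the one of `𝓠`: the difference has degree less than
`N - 1`, and it has no powers less than `k ^ (N - 1)`. -/
theorem P_logDeriv : Dk P = P * (((N : Ser K) * L⁻¹ + Vs) * Dk L) := by
  have hc := T.ccr
  rw [poisson] at hc
  have h1 : P * (((N : Ser K) * L⁻¹ + Vs) * Dk L) - Dk P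
      = Dk Lh * (P * D .s Mh - poisson P Mh - P * gs)
        - Dk Mh * (P * D .s Lh - poisson P Lh - P * fs) := by
    have hW : ((N : Ser K) * L⁻¹ + Vs) * Dk L = Dk L * D .s M - Dk M * D .s L := by
      rw [T.Ds_M, T.Dk_M]; ring
    rw [hW]
    simp only [poisson, T.Dk_Lh, T.Dx_Lh, T.Ds_Lh, T.Dk_Mh, T.Dx_Mh, T.Ds_Mh]
    linear_combination (-P * (Dk L * D .s M - Dk M * D .s L)
      + Dk P * (Dk L * D .x M - D .x L * Dk M)) * T.det + Dk P * hc
  have h2 : P * (((N : Ser K) * L⁻¹ + Vs) * Dk L) - Dk P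
      = P * (((N : Ser K) * L⁻¹ + Vs) * Dk L - (N : Ser K) * k K (-1))
        + (N : Ser K) * ((P - k K N) * k K (-1))
        - (Dk P - ((N : ℤ) : Ser K) * k K ((N : ℤ) - 1)) := by
    have : k K ((N : ℤ) - 1) = k K N * k K (-1) := by rw [← k_add]; rfl
    rw [this]
    push_cast
    ring
  refine (sub_eq_zero.1 (eq_zero_of_deg_ge (m := (N : ℤ) - 2) (n := (N : ℤ) - 1) ?_ ?_
    (by omega))).symm
  · rw [h2]
    exact ((((deg_of_leading T.P_lead).mul T.W_lead).mono (by omega)).add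
      (Deg.natCast_mul N ((T.P_lead.mul (deg_k _)).mono (by omega)))).sub
      (T.P_lead.Dk_leading.mono (by omega))
  · rw [h1]
    exact (GE.polynomial_mul T.Lh_ge.Dk T.Mh_ge').sub (GE.polynomial_mul T.Mh_ge.Dk T.Lh_ge')

theorem flow_s_k : Dk L * D .s M - Dk M * D .s L = Dk P * P⁻¹ := by
  rw [T.P_logDeriv, T.Ds_M, T.Dk_M]
  linear_combination (-(((N : Ser K) * L⁻¹ + Vs) * Dk L)) * T.P_mul_inv

/-- Both sides have negative degree, and by `P_logDeriv` and the closedness of logarithmic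
derivatives their difference does not
depend on `k`. -/
theorem flow_s_x [CharZero K] :
    D .x M * D .s L - D .x L * D .s M = -(D .x P * P⁻¹) := by
  have hc := T.ccr
  rw [poisson] at hc
  have e1 := congrArg (D .x) T.flow_s_k
  have e2 := congrArg (D .s) hc
  have h1 : D .s (1 : Ser K) = 0 := (DDer .s).map_one
  rw [← Dk_logD T.P_mul_inv] at e1
  simp only [D_sub, D_mul, h1] at e1 e2
  set Z := D .x M * D .s L - D .x L * D .s M + D .x P * P⁻¹ with hZ
  have hDk : Dk Z = 0 := by
    rw [hZ, Dk_add, Dk_sub, Dk_mul, Dk_mul, ← e1]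
    simp only [Dk_D, D_D .x .s] at e2 ⊢
    linear_combination e2
  have hdeg : Deg (-1) Z := by
    have hA : D .x M * D .s L - D .x L * D .s M
        = D .s L * (1 + Vx) - D .x L * ((N : Ser K) * L⁻¹ + Vs) := by
      rw [T.Dx_M, T.Ds_M]; ring
    rw [hZ, hA]
    refine ((((T.deg_D_L _).mul (deg_one.add (T.Vx_deg.mono (by omega)))).mono (by omega)).sub
      (((T.deg_D_L _).mul (((deg_inv_L T.L_lead').natCast_mul N).add
        (T.Vs_deg.mono (by omega)))).mono (by omega))).add
      (((T.P_lead.D_leading _).mul T.deg_P_inv).mono (by omega))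
  have hge : GE 0 Z := (supp_of_Dk_eq_zero hDk).mono (by simp)
  linear_combination eq_zero_of_deg_ge hdeg hge (by omega)

theorem log_s_L [CharZero K] : D .s L = Dk P * P⁻¹ * D .x L - D .x P * P⁻¹ * Dk L := by
  have hc := T.ccr
  rw [poisson] at hc
  linear_combination Dk L * T.flow_s_x + D .x L * T.flow_s_k - D .s L * hc

theorem log_s_M [CharZero K] : D .s M = Dk P * P⁻¹ * D .x M - D .x P * P⁻¹ * Dk M := by
  have hc := T.ccr
  rw [poisson] at hc
  linear_combination Dk M * T.flow_s_x + D .x M * T.flow_s_k - D .s M * hc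

theorem s_L [CharZero K] : D .s L * P = poisson P L := by
  rw [T.log_s_L, poisson]
  linear_combination (Dk P * D .x L - D .x P * Dk L) * T.P_mul_inv

theorem s_M [CharZero K] : D .s M * P = poisson P M := by
  rw [T.log_s_M, poisson]
  linear_combination (Dk P * D .x M - D .x P * Dk M) * T.P_mul_inv

/-- The curvature of the flows `tₙ` and `s` commutes with `𝓛` and `𝓜`, hence does not depend on
`k`; it has negative degree, since `𝓑ₙ` is the part of degree `≥ 0` of a function satisfying the
`s`-flow. -/
theorem B_P [CharZero K] (n : ℕ+) :
    -(D .s (calB L n)) * P = -(D (.t n) P) - poisson P (calB L n) := by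
  have hL := poisson_curvature T.P_mul_inv (.t n) T.log_s_L (T.lax_L n)
  have hM := poisson_curvature T.P_mul_inv (.t n) T.log_s_M (T.lax_M n)
  set B := calB L n with hB
  set H := D .s B - D (.t n) P * P⁻¹ + Dk B * (D .x P * P⁻¹) - D .x B * (Dk P * P⁻¹) with hH
  have hge : GE 0 H :=
    (supp_of_Dk_eq_zero (Dk_eq_zero_of_poisson T.ccr hL hM)).mono (by simp)
  set G := projLT 0 (L ^ (n : ℕ)) with hG
  have hGd : Deg (-1) G := (deg_projLT 0 _).mono (by omega)
  have hBG : B = L ^ (n : ℕ) - G := by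
    rw [← projGE_add_projLT 0 (L ^ (n : ℕ)), hB, calB, hG, add_sub_cancel_right]
  have e1 : D .s (L ^ (n : ℕ)) = Dk P * P⁻¹ * D .x (L ^ (n : ℕ))
      - D .x P * P⁻¹ * Dk (L ^ (n : ℕ)) := by
    have h1 : D .s (L ^ (n : ℕ)) = ((n : ℕ) : Ser K) * L ^ ((n : ℕ) - 1) * D .s L :=
      (DDer .s).leibniz_pow _ _
    have h2 : D .x (L ^ (n : ℕ)) = ((n : ℕ) : Ser K) * L ^ ((n : ℕ) - 1) * D .x L :=
      (DDer .x).leibniz_pow _ _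
    have h3 : Dk (L ^ (n : ℕ)) = ((n : ℕ) : Ser K) * L ^ ((n : ℕ) - 1) * Dk L :=
      (DkDer Var K).leibniz_pow _ _
    rw [h1, h2, h3, T.log_s_L]
    ring
  have hH' : H = -D .s G - D (.t n) P * P⁻¹ - Dk G * (D .x P * P⁻¹)
      + D .x G * (Dk P * P⁻¹) := by
    rw [hH, hBG, D_sub, D_sub, Dk_sub, e1]
    ring
  have hα : ∀ w, Deg (-1) (D w P * P⁻¹) := fun w =>
    ((T.P_lead.D_leading w).mul T.deg_P_inv).mono (by omega)
  have hαk : Deg (-1) (Dk P * P⁻¹) :=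
    ((deg_of_leading T.P_lead).Dk.mul T.deg_P_inv).mono (by omega)
  have hdeg : Deg (-1) H := by
    rw [hH']
    exact ((((hGd.D _).neg.sub (hα _)).sub ((hGd.Dk.mul (hα _)).mono (by omega))).add
      (((hGd.D _).mul hαk).mono (by omega)))
  have h0 : H = 0 := eq_zero_of_deg_ge hdeg hge (by omega)
  rw [poisson]
  linear_combination (-P) * h0 + P * hH
    + (-D (.t n) P + Dk B * D .x P - D .x B * Dk P) * T.P_mul_inv

theorem isSolution [CharZero K] : IsSolution L M P :=
  ⟨T.lax_L, T.lax_M, T.ccr, T.s_L, T.s_M, T.B_P⟩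

end TwistorData

end hierarchy

end DMKP
end

theorem mainTheorem2 {K : Type*} [Field K] [CharZero K] (N : ℕ) (hN : 1 ≤ N)
    (b : DMKP.BasePoint K) (u v : ℕ+ → DMKP.Coef K) (p : Fin N → DMKP.Coef K)
    (L M P : DMKP.Ser K)
    (hL : L = DMKP.calL u) (hM : M = DMKP.calM N b L v) (hP : P = DMKP.calP N p)
    (c : LaurentSeries K) (f g : DMKP.Germ K)
    (hfg : DMKP.Germ.poisson c f g = 1)
    (hc : MvPowerSeries.constantCoeff M = MvPowerSeries.constantCoeff (DMKP.evalL c L))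
    (hf : DMKP.projLT 0 (f.eval c L M) = 0)
    (hg : DMKP.projLT 0 (g.eval c L M) = 0)
    (hf' : DMKP.projLT ((N : ℤ) - 1)
      (P * DMKP.D .s (f.eval c L M) - DMKP.poisson P (f.eval c L M)
        - P * f.ds.eval c L M) = 0)
    (hg' : DMKP.projLT ((N : ℤ) - 1)
      (P * DMKP.D .s (g.eval c L M) - DMKP.poisson P (g.eval c L M)
        - P * g.ds.eval c L M) = 0) :
    DMKP.IsSolution L M P ∧ P = DMKP.calQ N L v := by
  open DMKP in
  have hLl : Deg (-1) (L - k K 1) := hL ▸ leading_calL u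
  have hL0 : Deg 0 (L - k K 1) := hLl.mono (by omega)
  have hPl : Deg ((N : ℤ) - 1) (P - k K N) := hP ▸ leading_calP N p
  have chk : ∀ f : Germ K, Dk (f.eval c L M) =
      (f.dk c).eval c L M * Dk L + f.dx.eval c L M * Dk M := by
    intro f
    have h := map_eval hL0 hc isPartial_Dk f
    simp only [DkDer_apply, Dk_eq_zero (supp_X .s), mul_zero, add_zero] at h
    exact h
  have ch : ∀ w, w ≠ .s → ∀ f : Germ K, D w (f.eval c L M) =
      (f.dk c).eval c L M * D w L + f.dx.eval c L M * D w M := by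
    intro w hw f
    have h := map_eval hL0 hc (isPartial_D w) f
    simp only [DDer_apply, D_X_of_ne hw.symm, mul_zero, add_zero] at h
    exact h
  have chs : ∀ f : Germ K, D .s (f.eval c L M) =
      (f.dk c).eval c L M * D .s L + f.dx.eval c L M * D .s M + f.ds.eval c L M := by
    intro f
    have h := map_eval hL0 hc (isPartial_D .s) f
    simp only [DDer_apply, D_X_self, mul_one] at h
    exact h
  have T : TwistorData N L M P (dML N b L v) (f.eval c L M) (g.eval c L M)
      ((f.dk c).eval c L M) (f.dx.eval c L M) (f.ds.eval c L M)
      ((g.dk c).eval c L M) (g.dx.eval c L M) (g.ds.eval c L M)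
      (tail L v (DDer .x)) (tail L v (DDer .s)) (fun n => tail L v (DDer (.t n))) :=
    { L_lead := hLl
      P_lead := hPl
      Vx_deg := deg_tail hL0 (isPartial_D _) v
      Vs_deg := deg_tail hL0 (isPartial_D _) v
      Vt_deg := fun n => deg_tail hL0 (isPartial_D _) v
      Dk_M := hM ▸ Dk_calM hL0 N b v
      Dx_M := hM ▸ D_calM_x hL0 N b v
      Ds_M := hM ▸ D_calM_s hL0 N b v
      Dt_M := fun n => hM ▸ D_calM_t hL0 N b v n
      det := by
        have h := congrArg (evalHom hL0 hc) hfg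
        rw [Germ.poisson, map_sub, map_mul, map_mul, map_one] at h
        exact h
      Dk_Lh := chk f
      Dx_Lh := ch .x (by simp) f
      Ds_Lh := chs f
      Dt_Lh := fun n => ch (.t n) (by simp) f
      Dk_Mh := chk g
      Dx_Mh := ch .x (by simp) g
      Ds_Mh := chs g
      Dt_Mh := fun n => ch (.t n) (by simp) g
      Lh_ge := ge_of_projLT hf
      Mh_ge := ge_of_projLT hg
      Lh_ge' := ge_of_projLT hf'
      Mh_ge' := ge_of_projLT hg' }
  refine ⟨T.isSolution, sub_eq_zero.1 (eq_zero_of_logDeriv (N := N) ?_ T.W_lead ?_)⟩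
  · have := hPl.sub (leading_calQ hL0 N v)
    rwa [sub_sub_sub_cancel_right] at this
  · rw [Dk_sub, Dk_calQ hL0 N v hN, sub_mul, ← T.P_logDeriv]
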